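/- Setting. Let $d\ge 1$, let $\mathcal X\subset\mathbb R^d$ be compact, $0<\beta\le 1$ and $L,\tau>0$. Let $\mathcal F(\beta,L)$ be the set of symmetric functions $f:\mathcal X\times\mathcal X\to\mathbb R$ (that is, $f(x,x')=f(x',x)$) with $|f(x,x')-f(\tilde x,x')|\le L\|x-\tilde x\|^\beta$ and $|f(x,x')|\le L$ for all $x,\tilde x,x'\in\mathcal X$. For every $f\in\mathcal F(\beta,L)$ let $Q_f(\cdot\mid x,x')$ be a Markov kernel from $\mathcal X\times\mathcal X$ to $\mathbb R$ with mean $f(x,x')$ and variance $\sigma^2(x,x')<\tau$. Given node covariates $X_1,\dots,X_n\in\mathcal X$, the outcomes $Y_{i_1i_2}$, $1\le i_1<i_2\le n$, are independent with $Y_{i_1i_2}\sim Q_f(\cdot\mid X_{i_1},X_{i_2})$, and $Y_{i_2i_1}=Y_{i_1i_2}$. With $I_n=\{(i_1,i_2):1\le i_1\ne i_2\le n\}$ and $K_h(z)=h^{-d}K(z/h)$, the regularized smoother at a query $(x,x')\in\mathcal X^2$ is $$\hat f_{n,h}(x,x')=\frac{|I_n|^{-1}\sum_{(i_1,i_2)\in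 I_n}Y_{i_1i_2}\{K_h(x-X_{i_1})K_h(x'-X_{i_2})+\lambda_n\}}{|I_n|^{-1}\sum_{(i_1,i_2)\in I_n}\{K_h(x-X_{i_1})K_h(x'-X_{i_2})+\lambda_n\}}.$$ Here $K$ is a bounded, compactly supported, symmetric ($K(-z)=K(z)$) probability density on $\mathbb R^d$ with mean zero and finite second moment, such that $\underline k\,\sup_z K(z)\le\inf_{\|z\|\le r}K(z)$ for some $\underline k,r>0$. The covariates follow one of two designs: (a) fixed design: $X_1,\dots,X_n$ are deterministic points of $\mathcal X$ with $c_Xn^{-1/d}\le\min_{i\ne j}\|X_i-X_j\|$ and $\sup_{y\in\mathcal X}\min_j\|y-X_j\|\le C_Xn^{-1/d}$, where $c_X,C_X>0$; (b) random design: $X_1,\dots,X_n$ are i.i.d. with a continuous density $m$ on $\mathcal X$ satisfying $0<l\le m\le u<\infty$. Finally let $c_0>0$; the query points $x,x'\in\mathcal X$ are assumed to satisfy $\mathrm{vol}(\mathcal X\cap\{y:\|y-x\|\le t\})\ge c_0t^d$ and $\mathrm{vol}(\mathcal X\cap\{y:\|y-x'\|\le t\})\ge c_0t^d$ for all $0<t\le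 1$ (for interior points of $\mathcal X$ this holds for some $c_0>0$). Put $$\rho_1(n,h)=\sup_{f\in\mathcal F(\beta,L)}\big|f(x,x')-\mathbb E[\hat f_{n,h}(x,x')]\big|^2,\qquad \rho_2(n,h)=\sup_{f\in\mathcal F(\beta,L)}\mathbb E\big[\mathrm{Var}[\hat f_{n,h}(x,x')\mid X_1,\dots,X_n]\big],$$ $$\rho_3(n,h)=\sup_{f\in\mathcal F(\beta,L)}\mathrm{Var}\big[f(x,x')-\mathbb E[\hat f_{n,h}(x,x')\mid X_1,\dots,X_n]\big].$$ Theorem. Let $\nu>0$. There is a constant $C>0$, depending only on $d,\mathcal X,\beta,L,\tau,\nu,K,c_X,C_X,l,u,c_0$ (in particular not on $n$ and $h$), such that for all $n\ge 2$, $h$ and $\lambda_n$ with $n^{-1/d}\le h\le 1$ and $(nh^d)^{-\nu}\le\lambda_n\le h^d$ the following hold, $\hat f_{n,h}(x,x')$ being square integrable in both designs. 1. In both designs, $\rho_1(n,h)\le Ch^{2\beta}$ and $\rho_2(n,h)\le C(nh^d)^{-2}$. 2. In the fixed design (a), $\rho_3(n,h)=0$; in the random design (b), $\rho_3(n,h)\le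 Ch^{2\beta}(nh^d)^{-1}$. -/

import Mathlib

open MeasureTheory ProbabilityTheory
open scoped ENNReal

noncomputable section

namespace LinkRegression

/-- The Euclidean space `ℝ^d`. -/
abbrev E (d : ℕ) := EuclideanSpace ℝ (Fin d)

/-! ### The regression model -/

/-- The class `F(β, L)` of symmetric link regression functions on `𝒳 × 𝒳` that are `β`-Hölder in
each argument (by symmetry it is enough to ask it of the first one) with constant `L`, and bounded
by `L`. -/
def holderClass {d : ℕ} (𝒳 : Set (E d)) (β L : ℝ) : Set (𝒳 → 𝒳 → ℝ) :=
  {f | (∀ x x' : 𝒳, f x x' = f x' x) ∧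
    (∀ x y x' : 𝒳, |f x x' - f y x'| ≤ L * ‖(x : E d) - (y : E d)‖ ^ β) ∧
    (∀ x x' : 𝒳, |f x x'| ≤ L)}

/-- The conditional law `Q(· | x, x')` of an outcome has mean `f(x, x')` and variance smaller
than `τ`, at every pair `(x, x')`. (`evariance` is the variance with value `∞` outside `L²`.) -/
def HasMeanAndVarianceLT {d : ℕ} {𝒳 : Set (E d)} (Q : Kernel (𝒳 × 𝒳) ℝ) (f : 𝒳 → 𝒳 → ℝ)
    (τ : ℝ) : Prop :=
  ∀ x x' : 𝒳, (∫ y, y ∂(Q (x, x')) = f x x') ∧ evariance id (Q (x, x')) < ENNReal.ofReal τ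

/-- The index pairs `i₁ < i₂`; there is one independent outcome for each of them. -/
abbrev Pair (n : ℕ) := {p : Fin n × Fin n // p.1 < p.2}

/-- Given node covariates `X`, the outcomes `Y_{i₁ i₂}`, `i₁ < i₂`, are independent with
`Y_{i₁ i₂} ∼ Q(· | X_{i₁}, X_{i₂})`. -/
def outcomeKernel {d : ℕ} {𝒳 : Set (E d)} (n : ℕ) (Q : Kernel (𝒳 × 𝒳) ℝ) [IsMarkovKernel Q] :
    Kernel (Fin n → 𝒳) (Pair n → ℝ) where
  toFun X := Measure.pi fun p : Pair n => Q (X p.1.1, X p.1.2)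
  measurable' := by
    refine Measurable.measure_of_isPiSystem_of_isProbabilityMeasure
      generateFrom_pi.symm isPiSystem_pi ?_
    rintro _ ⟨t, ht, rfl⟩
    simp only [Measure.pi_pi]
    refine Finset.measurable_prod _ fun p _ => ?_
    have hm : Measurable fun X : Fin n → 𝒳 => (X p.1.1, X p.1.2) := by fun_prop
    exact (Kernel.measurable_coe Q (ht p (Set.mem_univ p))).comp hm

/-- The joint law of all covariates and all outcomes, when `μ` is the law of the covariates. -/
def dataLaw {d : ℕ} {𝒳 : Set (E d)} {n : ℕ} (μ : Measure (Fin n → 𝒳)) (Q : Kernel (𝒳 × 𝒳) ℝ)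
    [IsMarkovKernel Q] : Measure ((Fin n → 𝒳) × (Pair n → ℝ)) :=
  μ ⊗ₘ outcomeKernel n Q

/-- The σ-algebra generated by the covariates. -/
abbrev covariateSigma {d : ℕ} (𝒳 : Set (E d)) (n : ℕ) :
    MeasurableSpace ((Fin n → 𝒳) × (Pair n → ℝ)) :=
  MeasurableSpace.comap Prod.fst inferInstance

/-- The outcomes extended symmetrically, `Y_{i₁ i₂} = Y_{i₂ i₁}` (with an unused value at
`i₁ = i₂`). -/
def outcome {n : ℕ} (Y : Pair n → ℝ) (i j : Fin n) : ℝ :=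
  if hij : i < j then Y ⟨(i, j), hij⟩ else if hji : j < i then Y ⟨(j, i), hji⟩ else 0

/-! ### The regularized product-kernel smoother -/

/-- The rescaled kernel `K_h(z) = h^{-d} K(z / h)`. -/
def scaledKernel {d : ℕ} (K : E d → ℝ) (h : ℝ) (z : E d) : ℝ :=
  (h ^ d)⁻¹ * K (h⁻¹ • z)

/-- The index set `I_n` of ordered pairs of distinct indices. -/
abbrev indexSet (n : ℕ) : Finset (Fin n × Fin n) := Finset.univ.offDiag

/-- The regularized kernel smoother at the query `(x, x')`, as a function of the data. -/
def smoother {d : ℕ} {𝒳 : Set (E d)} {n : ℕ} (K : E d → ℝ) (h lam : ℝ) (x x' : 𝒳)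
    (ω : (Fin n → 𝒳) × (Pair n → ℝ)) : ℝ :=
  (((indexSet n).card : ℝ)⁻¹ * ∑ p ∈ indexSet n, outcome ω.2 p.1 p.2 *
      (scaledKernel K h ((x : E d) - (ω.1 p.1 : E d)) *
        scaledKernel K h ((x' : E d) - (ω.1 p.2 : E d)) + lam)) /
    (((indexSet n).card : ℝ)⁻¹ * ∑ p ∈ indexSet n,
      (scaledKernel K h ((x : E d) - (ω.1 p.1 : E d)) *
        scaledKernel K h ((x' : E d) - (ω.1 p.2 : E d)) + lam))

/-- The conditions on the kernel. -/
structure IsLinkKernel {d : ℕ} (K : E d → ℝ) : Prop where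
  measurable : Measurable K
  nonneg : ∀ z, 0 ≤ K z
  integral_eq_one : ∫ z, K z = 1
  compact_support : HasCompactSupport K
  symmetric : ∀ z, K (-z) = K z
  bounded : BddAbove (Set.range K)
  mean_zero : ∫ z, K z • z = 0
  second_moment : Integrable fun z => ‖z‖ ^ 2 * K z
  lower_bound : ∃ k > 0, ∃ r > 0, ∀ z, ‖z‖ ≤ r → k * (⨆ w, K w) ≤ K z

/-! ### The two designs -/

/-- Fixed design: the covariates are separated by at least `cX n^{-1/d}`, and every point of `𝒳`
is within `CX n^{-1/d}` of one of them. -/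
def IsFixedDesign {d n : ℕ} {𝒳 : Set (E d)} (cX CX : ℝ) (X : Fin n → 𝒳) : Prop :=
  (∀ i j, i ≠ j → cX / (n : ℝ) ^ (1 / (d : ℝ)) ≤ ‖(X i : E d) - (X j : E d)‖) ∧
    ∀ y : 𝒳, ∃ j, ‖(y : E d) - (X j : E d)‖ ≤ CX / (n : ℝ) ^ (1 / (d : ℝ))

/-- The law of a single covariate with density `m` with respect to Lebesgue measure on `𝒳`. -/
def marginalLaw {d : ℕ} {𝒳 : Set (E d)} (m : 𝒳 → ℝ) : Measure 𝒳 :=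
  ((volume : Measure (E d)).comap Subtype.val).withDensity fun y => ENNReal.ofReal (m y)

/-- `m` is a continuous probability density on `𝒳` with `l ≤ m ≤ u`. -/
structure IsDesignDensity {d : ℕ} {𝒳 : Set (E d)} (l u : ℝ) (m : 𝒳 → ℝ) : Prop where
  continuous : Continuous m
  lower : ∀ y, l ≤ m y
  upper : ∀ y, m y ≤ u
  isProbabilityMeasure : IsProbabilityMeasure (marginalLaw m)

/-- Random design: the joint law of `n` i.i.d. covariates with density `m`. -/
def randomDesignLaw {d : ℕ} {𝒳 : Set (E d)} (n : ℕ) (m : 𝒳 → ℝ) : Measure (Fin n → 𝒳) :=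
  Measure.pi fun _ => marginalLaw m

/-- `𝒳` does not get thin at `x`: its balls about `x` of radius `t ≤ 1` have volume at
least `c₀ t^d`. Every interior point of `𝒳` satisfies this for some `c₀ > 0`. -/
def VolumeRegularAt {d : ℕ} (𝒳 : Set (E d)) (c₀ : ℝ) (x : E d) : Prop :=
  ∀ t : ℝ, 0 < t → t ≤ 1 → ENNReal.ofReal (c₀ * t ^ d) ≤ volume (𝒳 ∩ Metric.closedBall x t)

/-! ### The three terms -/

section Terms

variable {d : ℕ} {𝒳 : Set (E d)} {β L : ℝ} {n : ℕ} (μ : Measure (Fin n → 𝒳))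
  (Q : holderClass 𝒳 β L → Kernel (𝒳 × 𝒳) ℝ) [∀ f, IsMarkovKernel (Q f)]
  (K : E d → ℝ) (h lam : ℝ) (x x' : 𝒳)

/-- `ρ₁`: the supremum over `f` of the squared bias. -/
def rho1 : ℝ≥0∞ :=
  ⨆ f : holderClass 𝒳 β L,
    ENNReal.ofReal (|f.1 x x' - ∫ ω, smoother K h lam x x' ω ∂(dataLaw μ (Q f))| ^ 2)

/-- `ρ₂`: the supremum over `f` of the expected conditional variance given the covariates. -/
def rho2 : ℝ≥0∞ :=
  ⨆ f : holderClass 𝒳 β L,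
    ENNReal.ofReal (∫ ω, condVar (covariateSigma 𝒳 n) (smoother K h lam x x') (dataLaw μ (Q f)) ω
      ∂(dataLaw μ (Q f)))

/-- `ρ₃`: the supremum over `f` of the variance of the conditional bias given the covariates. -/
def rho3 : ℝ≥0∞ :=
  ⨆ f : holderClass 𝒳 β L,
    evariance (fun ω => f.1 x x' -
      ((dataLaw μ (Q f))[smoother K h lam x x' | covariateSigma 𝒳 n]) ω) (dataLaw μ (Q f))

end Terms

end LinkRegression

end

noncomputable section

namespace LinkRegression

/-! Given the covariates $X$, the smoother is a convex combination of independent outcomes. Hence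
its conditional mean $T(X)$ (`condMean`) is a weighted average of values of $f$, and its conditional
variance is at most $\tau$ times the sum of the squared coefficients. Both are governed by the
denominator $V(X)$ (`meanWeight`). If $V\ge v$ for a constant $v>0$, then $|T-f(x,x')|=O(h^\beta)$:
the kernel part only sees values of $f$ at distance $O(h)$, and the regularization part is at most
of order $\lambda_n/v\le h^\beta/v$ (`abs_condMean_sub_le`). Moreover each coefficient is
$O((nh^d)^{-2})$, hence so is the conditional variance (`sum_sq_pairCoeff_le`).

The event $V<v$ is negligible. If the balls of radius $rh$ about both queries contain of order
$nh^d$ covariates, then $V$ is bounded below (`le_meanWeight`). This count follows from a volume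
covering argument in the fixed design and from a Chernoff bound in the random one. In both,
$P(V<v)\le D(nh^d)^{-(2\nu+2)}$. Since $(nh^d)^{-\nu}\le\lambda_n\le h^d\le h^\beta$, this is at
most $Dh^{2\beta}(nh^d)^{-2}$ (`Tuning.rpow_neg_le`), below all three rates, so on that event
trivial bounds suffice. This gives $\rho_1$ and $\rho_2$.

For $\rho_3$, $T$ is a function of $X$ alone, so its variance vanishes in the fixed design. In the
random design put $\rho=E[V(T-f(x,x'))]/E[V]$ (`biasRatio`). Then $Z=V(T-f(x,x')-\rho)$ has mean
zero and no denominator: it is a U-statistic of order two with summands of relative size $h^\beta$.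
Disjoint index pairs are uncorrelated, so the variance of $Z$ is $O(h^{2\beta}(nh^d)^{-1})$
(`variance_sum_pair_le`, `variance_centred_le`). On $V\ge v$ one has $(T-f(x,x')-\rho)^2\le
Z^2/v^2$, which transfers the bound to $T$. -/

/-- Quantitative form of the conditions on the kernel. -/
structure KernelBounds {d : ℕ} (K : E d → ℝ) (M κ R r : ℝ) : Prop where
  measurable : Measurable K
  nonneg : ∀ z, 0 ≤ K z
  integral_eq_one : ∫ z, K z = 1
  one_le_M : 1 ≤ M
  le_M : ∀ z, K z ≤ M
  one_le_R : 1 ≤ R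
  norm_le : ∀ z, K z ≠ 0 → ‖z‖ ≤ R
  κ_pos : 0 < κ
  r_pos : 0 < r
  r_le_one : r ≤ 1
  κ_le : ∀ z, ‖z‖ ≤ r → κ ≤ K z

/-- The constraints relating sample size, bandwidth and regularization. -/
structure Tuning (d n : ℕ) (h lam ν : ℝ) : Prop where
  one_le_d : 1 ≤ d
  two_le_n : 2 ≤ n
  h_pos : 0 < h
  h_le_one : h ≤ 1
  one_le_nh : 1 ≤ (n : ℝ) * h ^ d
  lam_pos : 0 < lam
  lam_le : lam ≤ h ^ d
  inv_le : (h ^ d)⁻¹ ≤ ((n : ℝ) * h ^ d) ^ ν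

/-- The supremum of $K$ is positive because $K$ integrates to one, so $\kappa=\underline k\sup K$ is
a genuine lower bound near the origin. Requiring $M,R\ge1$ and $r\le1$ is a normalization that
simplifies later constants. -/
lemma IsLinkKernel.exists_kernelBounds {d : ℕ} {K : E d → ℝ} (hK : IsLinkKernel K) :
    ∃ M κ R r, KernelBounds K M κ R r := by
  obtain ⟨k, hk, r, hr, hlow⟩ := hK.lower_bound
  obtain ⟨M, hM⟩ := hK.bounded
  obtain ⟨R, hR⟩ := hK.compact_support.isCompact.isBounded.exists_norm_le
  have hsup : 0 < ⨆ w, K w := by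
    by_contra hcon
    have hz : ∀ z, K z = 0 := fun z =>
      le_antisymm ((le_ciSup hK.bounded z).trans (not_lt.1 hcon)) (hK.nonneg z)
    have := hK.integral_eq_one
    simp [hz] at this
  refine ⟨max M 1, k * ⨆ w, K w, max R 1, min r 1, hK.measurable, hK.nonneg, hK.integral_eq_one,
    le_max_right _ _, fun z => (hM ⟨z, rfl⟩).trans (le_max_left _ _), le_max_right _ _,
    fun z hz => (hR z (subset_tsupport _ hz)).trans (le_max_left _ _), by positivity,
    by positivity, min_le_right _ _, fun z hz => hlow z (hz.trans (min_le_left _ _))⟩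

lemma indexSet_card_le (n : ℕ) : ((indexSet n).card : ℝ) ≤ (n : ℝ) ^ 2 := by
  simp only [Finset.offDiag_card, Finset.card_univ, Fintype.card_fin]
  have : n * n - n ≤ n ^ 2 := by rw [sq]; omega
  exact_mod_cast this

/-! ### Consequences of the bandwidth and regularization ranges. -/

section Tuning

variable {d n : ℕ} {h lam ν : ℝ}

/-- The field `inv_le` records that the range $(nh^d)^{-\nu}\le\lambda_n\le h^d$ is non-empty;
beyond this, the lower bound on $\lambda_n$ is kept only as positivity. -/
lemma tuning_of_bounds (hd : 1 ≤ d) (hn : 2 ≤ n) (hnh : (n : ℝ) ^ (-(1 / (d : ℝ))) ≤ h)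
    (hh : h ≤ 1) (hlam : 1 / ((n : ℝ) * h ^ d) ^ ν ≤ lam) (hlam' : lam ≤ h ^ d) :
    Tuning d n h lam ν := by
  have hn0 : (0 : ℝ) < n := by positivity
  have hh0 : 0 < h := lt_of_lt_of_le (by positivity) hnh
  have hs : 0 < (n : ℝ) * h ^ d := by positivity
  have hpow := pow_le_pow_left₀ (by positivity) hnh d
  have hd0 : (d : ℝ) ≠ 0 := by positivity
  rw [← Real.rpow_natCast, ← Real.rpow_mul hn0.le, neg_mul, one_div, inv_mul_cancel₀ hd0,
    Real.rpow_neg_one] at hpow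
  have hsν : 0 < ((n : ℝ) * h ^ d) ^ ν := by positivity
  refine ⟨hd, hn, hh0, hh, ?_, lt_of_lt_of_le (by positivity) hlam, hlam', ?_⟩
  · rwa [inv_le_iff_one_le_mul₀' hn0] at hpow
  · rw [inv_le_comm₀ (by positivity) hsν, ← one_div]
    exact hlam.trans hlam'

namespace Tuning

lemma n_pos (H : Tuning d n h lam ν) : (0 : ℝ) < n := by
  have := H.two_le_n
  positivity

lemma hd_pos (H : Tuning d n h lam ν) : 0 < h ^ d := pow_pos H.h_pos d

lemma hd_le_one (H : Tuning d n h lam ν) : h ^ d ≤ 1 := pow_le_one₀ H.h_pos.le H.h_le_one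

lemma nh_pos (H : Tuning d n h lam ν) : 0 < (n : ℝ) * h ^ d := mul_pos H.n_pos H.hd_pos

lemma hd_le_rpow (H : Tuning d n h lam ν) {β : ℝ} (hβ1 : β ≤ 1) : h ^ d ≤ h ^ β := by
  calc h ^ d ≤ h ^ 1 := pow_le_pow_of_le_one H.h_pos.le H.h_le_one H.one_le_d
    _ = h ^ (1 : ℝ) := by simp
    _ ≤ h ^ β := Real.rpow_le_rpow_of_exponent_ge H.h_pos H.h_le_one hβ1

lemma lam_le_rpow (H : Tuning d n h lam ν) {β : ℝ} (hβ1 : β ≤ 1) : lam ≤ h ^ β :=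
  H.lam_le.trans (H.hd_le_rpow hβ1)

lemma rpow_two_mul (H : Tuning d n h lam ν) (β : ℝ) : h ^ (2 * β) = (h ^ β) ^ 2 := by
  rw [mul_comm, Real.rpow_mul H.h_pos.le, Real.rpow_two]

lemma card_pos (H : Tuning d n h lam ν) : (0 : ℝ) < (indexSet n).card := by
  have h2 := H.two_le_n
  simp only [Finset.offDiag_card, Finset.card_univ, Fintype.card_fin]
  have : 0 < n * n - n := by
    have : n * 2 ≤ n * n := Nat.mul_le_mul_left n h2
    omega
  exact_mod_cast this

lemma le_card (H : Tuning d n h lam ν) : (n : ℝ) ^ 2 / 2 ≤ ((indexSet n).card : ℝ) := by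
  have h2 := H.two_le_n
  simp only [Finset.offDiag_card, Finset.card_univ, Fintype.card_fin]
  have : n * 2 ≤ n * n := Nat.mul_le_mul_left n h2
  have h3 : n ^ 2 ≤ (n * n - n) * 2 := by rw [sq]; omega
  rw [div_le_iff₀ (by norm_num)]
  exact_mod_cast h3

/-- A high negative power of `n h ^ d` is controlled by the squared bias and the squared
effective sample size. -/
lemma rpow_neg_le (H : Tuning d n h lam ν) {β : ℝ} (hβ1 : β ≤ 1) :
    (((n : ℝ) * h ^ d) ^ (2 * ν + 2))⁻¹ ≤ h ^ (2 * β) * (((n : ℝ) * h ^ d) ^ 2)⁻¹ := by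
  have hs := H.nh_pos
  -- The part $2\nu$ of the exponent pays for $h^{2\beta}$ through `inv_le`; the part $2$ is kept.
  rw [Real.rpow_add hs, mul_inv, Real.rpow_two, mul_comm 2 ν, Real.rpow_mul hs.le, Real.rpow_two,
    H.rpow_two_mul]
  gcongr
  rw [← inv_pow]
  gcongr
  calc (((n : ℝ) * h ^ d) ^ ν)⁻¹ ≤ h ^ d := by
        rw [inv_le_comm₀ (by positivity) H.hd_pos]
        exact H.inv_le
    _ ≤ h ^ β := H.hd_le_rpow hβ1

end Tuning

end Tuning

/-! ### Deterministic bounds for the weights and the conditional bias. -/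

section Weights

variable {d n : ℕ} {𝒳 : Set (E d)} {K : E d → ℝ} {M κ R r β L h lam ν : ℝ}

/-- The unregularized weight `K_h(x - X_i) K_h(x' - X_j)` of an index pair. -/
def kernelWeight (K : E d → ℝ) (h : ℝ) (x x' : 𝒳) (X : Fin n → 𝒳) (p : Fin n × Fin n) : ℝ :=
  scaledKernel K h ((x : E d) - (X p.1 : E d)) * scaledKernel K h ((x' : E d) - (X p.2 : E d))

/-- The sum of the regularized weights. -/
def totalWeight (K : E d → ℝ) (h lam : ℝ) (x x' : 𝒳) (X : Fin n → 𝒳) : ℝ :=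
  ∑ p ∈ indexSet n, (kernelWeight K h x x' X p + lam)

/-- The average of the regularized weights, i.e. the denominator of the smoother. -/
def meanWeight (K : E d → ℝ) (h lam : ℝ) (x x' : 𝒳) (X : Fin n → 𝒳) : ℝ :=
  ((indexSet n).card : ℝ)⁻¹ * totalWeight K h lam x x' X

/-- The conditional mean of the smoother given the covariates. -/
def condMean (K : E d → ℝ) (h lam : ℝ) (x x' : 𝒳) (f : 𝒳 → 𝒳 → ℝ) (X : Fin n → 𝒳) : ℝ :=
  (∑ p ∈ indexSet n, (kernelWeight K h x x' X p + lam) * f (X p.1) (X p.2)) /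
    totalWeight K h lam x x' X

/-- The coefficient of the outcome of an unordered pair in the smoother. -/
def pairCoeff (K : E d → ℝ) (h lam : ℝ) (x x' : 𝒳) (X : Fin n → 𝒳) (q : Pair n) : ℝ :=
  ((kernelWeight K h x x' X q.1 + lam) + (kernelWeight K h x x' X q.1.swap + lam)) /
    totalWeight K h lam x x' X

lemma KernelBounds.scaledKernel_nonneg (hK : KernelBounds K M κ R r) (hh : 0 < h) (z : E d) :
    0 ≤ scaledKernel K h z :=
  mul_nonneg (by positivity) (hK.nonneg _)

lemma KernelBounds.scaledKernel_le (hK : KernelBounds K M κ R r) (hh : 0 < h) (z : E d) :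
    scaledKernel K h z ≤ (h ^ d)⁻¹ * M :=
  mul_le_mul_of_nonneg_left (hK.le_M _) (by positivity)

lemma KernelBounds.le_scaledKernel (hK : KernelBounds K M κ R r) (hh : 0 < h) {z : E d}
    (hz : ‖z‖ ≤ r * h) : (h ^ d)⁻¹ * κ ≤ scaledKernel K h z := by
  refine mul_le_mul_of_nonneg_left (hK.κ_le _ ?_) (by positivity)
  rw [norm_smul, norm_inv, Real.norm_of_nonneg hh.le, inv_mul_le_iff₀ hh]
  linarith

lemma KernelBounds.norm_le_of_scaledKernel_ne_zero (hK : KernelBounds K M κ R r) (hh : 0 < h)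
    {z : E d} (hz : scaledKernel K h z ≠ 0) : ‖z‖ ≤ R * h := by
  have := hK.norm_le _ (right_ne_zero_of_mul hz)
  rw [norm_smul, norm_inv, Real.norm_of_nonneg hh.le, inv_mul_le_iff₀ hh] at this
  linarith

lemma KernelBounds.kernelWeight_nonneg (hK : KernelBounds K M κ R r) (hh : 0 < h) (x x' : 𝒳)
    (X : Fin n → 𝒳) (p) : 0 ≤ kernelWeight K h x x' X p :=
  mul_nonneg (hK.scaledKernel_nonneg hh _) (hK.scaledKernel_nonneg hh _)

lemma weight_pos (hK : KernelBounds K M κ R r) (H : Tuning d n h lam ν) (x x' : 𝒳)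
    (X : Fin n → 𝒳) (p) : 0 < kernelWeight K h x x' X p + lam :=
  add_pos_of_nonneg_of_pos (hK.kernelWeight_nonneg H.h_pos _ _ _ _) H.lam_pos

lemma weight_le (hK : KernelBounds K M κ R r) (H : Tuning d n h lam ν) (x x' : 𝒳)
    (X : Fin n → 𝒳) (p) : kernelWeight K h x x' X p + lam ≤ 2 * M ^ 2 * ((h ^ d)⁻¹) ^ 2 := by
  have h1 : kernelWeight K h x x' X p ≤ ((h ^ d)⁻¹ * M) * ((h ^ d)⁻¹ * M) :=
    mul_le_mul (hK.scaledKernel_le H.h_pos _) (hK.scaledKernel_le H.h_pos _)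
      (hK.scaledKernel_nonneg H.h_pos _)
      (mul_nonneg (inv_nonneg.2 H.hd_pos.le) (zero_le_one.trans hK.one_le_M))
  have h2 : 1 ≤ ((h ^ d)⁻¹ * M) :=
    one_le_mul_of_one_le_of_one_le (one_le_inv₀ H.hd_pos |>.2 H.hd_le_one) hK.one_le_M
  have h3 := H.lam_le.trans H.hd_le_one
  nlinarith

lemma totalWeight_pos (hK : KernelBounds K M κ R r) (H : Tuning d n h lam ν) (x x' : 𝒳)
    (X : Fin n → 𝒳) : 0 < totalWeight K h lam x x' X :=
  Finset.sum_pos (fun p _ => weight_pos hK H x x' X p)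
    (Finset.card_pos.1 (by exact_mod_cast H.card_pos))

lemma meanWeight_pos (hK : KernelBounds K M κ R r) (H : Tuning d n h lam ν) (x x' : 𝒳)
    (X : Fin n → 𝒳) : 0 < meanWeight K h lam x x' X :=
  mul_pos (inv_pos.2 H.card_pos) (totalWeight_pos hK H x x' X)

lemma totalWeight_eq (H : Tuning d n h lam ν) (x x' : 𝒳) (X : Fin n → 𝒳) :
    totalWeight K h lam x x' X = (indexSet n).card * meanWeight K h lam x x' X := by
  rw [meanWeight, mul_inv_cancel_left₀ H.card_pos.ne']

/-- A sum over ordered pairs of distinct indices, regrouped along unordered pairs. -/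
lemma sum_indexSet (F : Fin n × Fin n → ℝ) :
    ∑ p ∈ indexSet n, F p = ∑ q : Pair n, (F q.1 + F q.1.swap) := by
  have hsplit : indexSet n = (Finset.univ.filter fun p : Fin n × Fin n => p.1 < p.2) ∪
      (Finset.univ.filter fun p : Fin n × Fin n => p.2 < p.1) := by
    ext p
    simp [lt_or_lt_iff_ne]
  rw [hsplit, Finset.sum_union, Finset.sum_add_distrib]
  · congr 1
    · exact (Finset.sum_subtype _ (by simp) _)
    · rw [← Finset.sum_subtype (Finset.univ.filter fun p : Fin n × Fin n => p.1 < p.2)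
        (by simp) (fun p => F p.swap)]
      exact Finset.sum_nbij' Prod.swap Prod.swap (by simp) (by simp) (by simp) (by simp) (by simp)
  · rw [Finset.disjoint_filter]
    intro p _ h1 h2
    exact lt_asymm h1 h2

lemma outcome_pair (Y : Pair n → ℝ) (q : Pair n) : outcome Y q.1.1 q.1.2 = Y q := by
  simp [outcome, q.2]

lemma outcome_pair_swap (Y : Pair n → ℝ) (q : Pair n) :
    outcome Y q.1.swap.1 q.1.swap.2 = Y q := by
  simp [outcome, q.2, not_lt.2 q.2.le]

/-- The normalizations cancel and the two orders of a pair share one outcome. Grouping them gives a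
linear form in variables that are independent given $X$. -/
lemma smoother_eq_sum (H : Tuning d n h lam ν) (x x' : 𝒳) (X : Fin n → 𝒳) (Y : Pair n → ℝ) :
    smoother K h lam x x' (X, Y) = ∑ q, pairCoeff K h lam x x' X q * Y q := by
  have h1 : smoother K h lam x x' (X, Y) =
      (∑ p ∈ indexSet n, outcome Y p.1 p.2 * (kernelWeight K h x x' X p + lam)) /
        totalWeight K h lam x x' X :=
    mul_div_mul_left _ _ (inv_ne_zero H.card_pos.ne')
  rw [h1, sum_indexSet, Finset.sum_div]
  refine Finset.sum_congr rfl fun q _ => ?_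
  rw [outcome_pair, outcome_pair_swap, pairCoeff]
  ring

lemma sum_pairCoeff_mul (x x' : 𝒳) {f : 𝒳 → 𝒳 → ℝ} (hf : ∀ x x', f x x' = f x' x)
    (X : Fin n → 𝒳) :
    ∑ q, pairCoeff K h lam x x' X q * f (X q.1.1) (X q.1.2) = condMean K h lam x x' f X := by
  rw [condMean, sum_indexSet, Finset.sum_div]
  refine Finset.sum_congr rfl fun q _ => ?_
  rw [pairCoeff, Prod.fst_swap, Prod.snd_swap, hf (X q.1.2)]
  ring

lemma sum_pairCoeff (hK : KernelBounds K M κ R r) (H : Tuning d n h lam ν) (x x' : 𝒳)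
    (X : Fin n → 𝒳) : ∑ q, pairCoeff K h lam x x' X q = 1 := by
  -- Constants are reproduced: this is the case $f=1$.
  have h1 := sum_pairCoeff_mul (K := K) (h := h) (lam := lam) x x' (f := fun _ _ => 1)
    (fun _ _ => rfl) X
  simp only [mul_one, condMean] at h1
  rw [h1]
  exact div_self (totalWeight_pos hK H x x' X).ne'

lemma pairCoeff_nonneg (hK : KernelBounds K M κ R r) (H : Tuning d n h lam ν) (x x' : 𝒳)
    (X : Fin n → 𝒳) (q) : 0 ≤ pairCoeff K h lam x x' X q :=
  div_nonneg (add_nonneg (weight_pos hK H x x' X _).le (weight_pos hK H x x' X _).le)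
    (totalWeight_pos hK H x x' X).le

/-- For a probability vector, $\sum c_i^2\le\max_i c_i$; it therefore suffices to bound single
coefficients. -/
lemma sum_sq_le_of_le {ι : Type*} (s : Finset ι) (c : ι → ℝ) {a : ℝ} (h0 : ∀ i ∈ s, 0 ≤ c i)
    (ha : ∀ i ∈ s, c i ≤ a) (h1 : ∑ i ∈ s, c i = 1) : ∑ i ∈ s, c i ^ 2 ≤ a := by
  calc ∑ i ∈ s, c i ^ 2 ≤ ∑ i ∈ s, a * c i := Finset.sum_le_sum fun i hi => by
        rw [sq]; exact mul_le_mul_of_nonneg_right (ha i hi) (h0 i hi)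
    _ = a := by rw [← Finset.mul_sum, h1, mul_one]

lemma sum_sq_pairCoeff_le_one (hK : KernelBounds K M κ R r) (H : Tuning d n h lam ν) (x x' : 𝒳)
    (X : Fin n → 𝒳) : ∑ q, pairCoeff K h lam x x' X q ^ 2 ≤ 1 :=
  sum_sq_le_of_le _ _ (fun q _ => pairCoeff_nonneg hK H x x' X q)
    (fun q _ => (Finset.single_le_sum (f := fun q => pairCoeff K h lam x x' X q)
      (fun q _ => pairCoeff_nonneg hK H x x' X q) (Finset.mem_univ q)).trans_eq
        (sum_pairCoeff hK H x x' X)) (sum_pairCoeff hK H x x' X)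

lemma sum_sq_pairCoeff_le (hK : KernelBounds K M κ R r) (H : Tuning d n h lam ν) (x x' : 𝒳)
    (X : Fin n → 𝒳) {v : ℝ} (hv : 0 < v) (hX : v ≤ meanWeight K h lam x x' X) :
    ∑ q, pairCoeff K h lam x x' X q ^ 2 ≤ 8 * M ^ 2 / v * (((n : ℝ) * h ^ d) ^ 2)⁻¹ := by
  refine sum_sq_le_of_le _ _ (fun q _ => pairCoeff_nonneg hK H x x' X q) (fun q _ => ?_)
    (sum_pairCoeff hK H x x' X)
  have hn := H.n_pos
  have hh := H.hd_pos
  have hS : (n : ℝ) ^ 2 / 2 * v ≤ totalWeight K h lam x x' X := by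
    rw [totalWeight_eq H]
    exact mul_le_mul H.le_card hX hv.le H.card_pos.le
  calc pairCoeff K h lam x x' X q
      ≤ (2 * M ^ 2 * ((h ^ d)⁻¹) ^ 2 + 2 * M ^ 2 * ((h ^ d)⁻¹) ^ 2) / ((n : ℝ) ^ 2 / 2 * v) :=
        div_le_div₀ (by positivity) (add_le_add (weight_le hK H x x' X _)
          (weight_le hK H x x' X _)) (by positivity) hS
    _ = _ := by field_simp; ring

/-- Bound on a weighted mean of values which are small where the kernel weight does not vanish. -/
lemma abs_weighted_sum_le {ι : Type*} (s : Finset ι) (k g : ι → ℝ) {lam a b : ℝ}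
    (hlam : 0 ≤ lam) (ha : 0 ≤ a) (hk : ∀ i ∈ s, 0 ≤ k i) (hb : ∀ i ∈ s, |g i| ≤ b)
    (hg : ∀ i ∈ s, k i ≠ 0 → |g i| ≤ a) :
    |∑ i ∈ s, (k i + lam) * g i| ≤ a * ∑ i ∈ s, (k i + lam) + s.card * (lam * b) := by
  rw [Finset.mul_sum, ← nsmul_eq_mul, ← Finset.sum_const, ← Finset.sum_add_distrib]
  refine (Finset.abs_sum_le_sum_abs _ _).trans (Finset.sum_le_sum fun i hi => ?_)
  rw [abs_mul, abs_of_nonneg (add_nonneg (hk i hi) hlam)]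
  have h1 : k i * |g i| ≤ k i * a := by
    by_cases hz : k i = 0
    · simp [hz]
    · exact mul_le_mul_of_nonneg_left (hg i hi hz) (hk i hi)
  have h2 := mul_le_mul_of_nonneg_left (hb i hi) hlam
  nlinarith [mul_nonneg ha hlam]

lemma abs_sub_le_two_mul {f : 𝒳 → 𝒳 → ℝ} (hf : f ∈ holderClass 𝒳 β L) (x x' y y' : 𝒳) :
    |f y y' - f x x'| ≤ 2 * L := by
  have h1 := hf.2.2 y y'
  have h2 := hf.2.2 x x'
  have := abs_sub (f y y') (f x x')
  linarith

lemma abs_sub_le_of_norm_sub_le {f : 𝒳 → 𝒳 → ℝ} (hf : f ∈ holderClass 𝒳 β L) (hL : 0 ≤ L)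
    (hβ0 : 0 ≤ β) {a : ℝ} {x x' y y' : 𝒳} (h1 : ‖(x : E d) - (y : E d)‖ ≤ a)
    (h2 : ‖(x' : E d) - (y' : E d)‖ ≤ a) : |f y y' - f x x'| ≤ 2 * L * a ^ β := by
  have e1 : |f x x' - f y x'| ≤ L * a ^ β := (hf.2.1 x y x').trans (by gcongr)
  have e2 : |f y x' - f y y'| ≤ L * a ^ β := by
    -- Symmetry moves the second argument to the first place, where the Hölder condition is stated.
    rw [hf.1 y x', hf.1 y y']
    exact (hf.2.1 x' y' y).trans (by gcongr)
  rw [abs_sub_comm]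
  have := abs_sub_le (f x x') (f y x') (f y y')
  linarith

lemma abs_sub_le_of_kernelWeight_ne_zero {f : 𝒳 → 𝒳 → ℝ} (hf : f ∈ holderClass 𝒳 β L)
    (hL : 0 ≤ L) (hβ0 : 0 ≤ β) (hβ1 : β ≤ 1) (hK : KernelBounds K M κ R r) (hh : 0 < h)
    {x x' : 𝒳} {X : Fin n → 𝒳} {p : Fin n × Fin n} (hp : kernelWeight K h x x' X p ≠ 0) :
    |f (X p.1) (X p.2) - f x x'| ≤ 2 * L * R * h ^ β := by
  have hR := zero_le_one.trans hK.one_le_R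
  have h1 := abs_sub_le_of_norm_sub_le hf hL hβ0
    (hK.norm_le_of_scaledKernel_ne_zero hh (left_ne_zero_of_mul hp))
    (hK.norm_le_of_scaledKernel_ne_zero hh (right_ne_zero_of_mul hp))
  have h2 : R ^ β ≤ R := by
    simpa using Real.rpow_le_rpow_of_exponent_le hK.one_le_R hβ1
  refine h1.trans ?_
  rw [Real.mul_rpow hR hh.le, mul_assoc (2 * L) R]
  gcongr

lemma condMean_sub (hK : KernelBounds K M κ R r) (H : Tuning d n h lam ν) (x x' : 𝒳)
    (f : 𝒳 → 𝒳 → ℝ) (X : Fin n → 𝒳) :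
    condMean K h lam x x' f X - f x x' =
      (∑ p ∈ indexSet n, (kernelWeight K h x x' X p + lam) * (f (X p.1) (X p.2) - f x x')) /
        totalWeight K h lam x x' X := by
  have hS := (totalWeight_pos hK H x x' X).ne'
  rw [condMean, eq_div_iff hS, sub_mul, div_mul_cancel₀ _ hS]
  simp only [mul_sub, Finset.sum_sub_distrib, ← Finset.sum_mul]
  rw [totalWeight, mul_comm (f x x')]

lemma abs_condMean_sub_le_two_mul (hK : KernelBounds K M κ R r) (H : Tuning d n h lam ν)
    {f : 𝒳 → 𝒳 → ℝ} (hf : f ∈ holderClass 𝒳 β L) (x x' : 𝒳) (X : Fin n → 𝒳) :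
    |condMean K h lam x x' f X - f x x'| ≤ 2 * L := by
  have hS := totalWeight_pos hK H x x' X
  rw [condMean_sub hK H, abs_div, abs_of_pos hS, div_le_iff₀ hS, totalWeight, Finset.mul_sum]
  refine (Finset.abs_sum_le_sum_abs _ _).trans (Finset.sum_le_sum fun i hi => ?_)
  rw [abs_mul, abs_of_pos (weight_pos hK H x x' X i), mul_comm]
  exact mul_le_mul_of_nonneg_right (abs_sub_le_two_mul hf _ _ _ _) (weight_pos hK H x x' X i).le

/-- Pairs with non-zero kernel weight give the Hölder error $2LRh^\beta$. The summands $\lambda_n$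
give at most $2L\lambda_n/v$, and $\lambda_n\le h^d\le h^\beta$. -/
lemma abs_condMean_sub_le (hK : KernelBounds K M κ R r) (H : Tuning d n h lam ν) (hL : 0 ≤ L)
    (hβ0 : 0 ≤ β) (hβ1 : β ≤ 1) {f : 𝒳 → 𝒳 → ℝ} (hf : f ∈ holderClass 𝒳 β L) (x x' : 𝒳)
    (X : Fin n → 𝒳) {v : ℝ} (hv : 0 < v) (hX : v ≤ meanWeight K h lam x x' X) :
    |condMean K h lam x x' f X - f x x'| ≤ (2 * L * R + 2 * L / v) * h ^ β := by
  have hS := totalWeight_pos hK H x x' X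
  have hR := zero_le_one.trans hK.one_le_R
  have hhβ : 0 < h ^ β := Real.rpow_pos_of_pos H.h_pos β
  rw [condMean_sub hK H, abs_div, abs_of_pos hS, div_le_iff₀ hS]
  refine (abs_weighted_sum_le _ _ _ H.lam_pos.le (a := 2 * L * R * h ^ β) (b := 2 * L)
    (by positivity)
    (fun p _ => hK.kernelWeight_nonneg H.h_pos x x' X p)
    (fun p _ => abs_sub_le_two_mul hf _ _ _ _)
    (fun p _ hp => abs_sub_le_of_kernelWeight_ne_zero hf hL hβ0 hβ1 hK H.h_pos hp)).trans ?_
  change _ * totalWeight K h lam x x' X + _ ≤ _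
  have h1 : (indexSet n).card * (lam * (2 * L)) ≤
      2 * L / v * h ^ β * totalWeight K h lam x x' X := by
    rw [totalWeight_eq H]
    calc (indexSet n).card * (lam * (2 * L))
        ≤ (indexSet n).card * (h ^ β * (2 * L)) := by gcongr; exact H.lam_le_rpow hβ1
      _ = 2 * L / v * h ^ β * ((indexSet n).card * v) := by field_simp
      _ ≤ _ := by gcongr
  linarith

open Classical in
/-- The indices of covariates at distance at most `a` from `x`. -/
def nearIndices (a : ℝ) (x : 𝒳) (X : Fin n → 𝒳) : Finset (Fin n) :=
  Finset.univ.filter fun i => ‖(x : E d) - (X i : E d)‖ ≤ a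

/-- Pairs with one index near each query have kernel weight at least $\kappa^2h^{-2d}$, and there
are at least $(\delta nh^d)^2/2$ such pairs off the diagonal. -/
lemma le_meanWeight (hK : KernelBounds K M κ R r) (H : Tuning d n h lam ν) {x x' : 𝒳}
    {X : Fin n → 𝒳} {δ : ℝ} (hδ : 2 ≤ δ * ((n : ℝ) * h ^ d))
    (hx : δ * ((n : ℝ) * h ^ d) ≤ (nearIndices (r * h) x X).card)
    (hx' : δ * ((n : ℝ) * h ^ d) ≤ (nearIndices (r * h) x' X).card) :
    κ ^ 2 * δ ^ 2 / 2 ≤ meanWeight K h lam x x' X := by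
  classical
  have hn := H.n_pos
  have hh := H.hd_pos
  have hκ := hK.κ_pos
  set A := nearIndices (r * h) x X
  set A' := nearIndices (r * h) x' X
  set D := (A ×ˢ A').filter fun p => p.1 ≠ p.2
  have hdiag : ((A ×ˢ A').filter fun p => p.1 = p.2).card ≤ A.card := by
    refine Finset.card_le_card_of_injOn Prod.fst (fun p hp => ?_) (fun p hp q hq e => ?_)
    · have := Finset.mem_coe.1 hp
      simp only [Finset.mem_filter, Finset.mem_product] at this
      exact this.1.1
    · have hp' := (Finset.mem_filter.1 (Finset.mem_coe.1 hp)).2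
      have hq' := (Finset.mem_filter.1 (Finset.mem_coe.1 hq)).2
      exact Prod.ext e (by rw [← hp', ← hq', e])
  have hcard : (A.card : ℝ) * A'.card ≤ A.card + D.card := by
    have := Finset.card_filter_add_card_filter_not (s := A ×ˢ A') (fun p => p.1 = p.2)
    rw [Finset.card_product] at this
    have : A.card * A'.card ≤ A.card + D.card := by
      rw [← this]; exact Nat.add_le_add_right hdiag _
    exact_mod_cast this
  -- Discarding the diagonal leaves at least $|A|(|A'|-1)$ pairs, which is at least half of the
  -- product bound because $\delta nh^d\ge2$.
  have hD : (δ * ((n : ℝ) * h ^ d)) ^ 2 / 2 ≤ D.card := by nlinarith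
  have hsum : D.card * (((h ^ d)⁻¹ * κ) * ((h ^ d)⁻¹ * κ)) ≤ totalWeight K h lam x x' X := by
    rw [← nsmul_eq_mul, ← Finset.sum_const]
    have hsub : D ⊆ indexSet n := fun p hp => by
      simpa using (Finset.mem_filter.1 hp).2
    refine le_trans (Finset.sum_le_sum fun p hp => ?_)
      (Finset.sum_le_sum_of_subset_of_nonneg hsub fun p _ _ => (weight_pos hK H x x' X p).le)
    obtain ⟨hpA, hpA'⟩ := Finset.mem_product.1 (Finset.mem_filter.1 hp).1
    have e1 := (Finset.mem_filter.1 hpA).2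
    have e2 := (Finset.mem_filter.1 hpA').2
    have : ((h ^ d)⁻¹ * κ) * ((h ^ d)⁻¹ * κ) ≤ kernelWeight K h x x' X p :=
      mul_le_mul (hK.le_scaledKernel H.h_pos e1) (hK.le_scaledKernel H.h_pos e2) (by positivity)
        (hK.scaledKernel_nonneg H.h_pos _)
    linarith [H.lam_pos]
  have hS := totalWeight_pos hK H x x' X
  rw [meanWeight, inv_mul_eq_div, le_div_iff₀ H.card_pos]
  calc κ ^ 2 * δ ^ 2 / 2 * (indexSet n).card ≤ κ ^ 2 * δ ^ 2 / 2 * (n : ℝ) ^ 2 := by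
        gcongr; exact indexSet_card_le n
    _ = (δ * ((n : ℝ) * h ^ d)) ^ 2 / 2 * (((h ^ d)⁻¹ * κ) * ((h ^ d)⁻¹ * κ)) := by
        field_simp
    _ ≤ D.card * (((h ^ d)⁻¹ * κ) * ((h ^ d)⁻¹ * κ)) := by gcongr
    _ ≤ _ := hsum

end Weights

/-- Joint measurability of $f$ is inherited from the kernel, whose mean it is. -/
lemma HasMeanAndVarianceLT.measurable {d : ℕ} {𝒳 : Set (E d)} {Q : Kernel (𝒳 × 𝒳) ℝ}
    {f : 𝒳 → 𝒳 → ℝ} {τ : ℝ} (hQ : HasMeanAndVarianceLT Q f τ) :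
    Measurable fun p : 𝒳 × 𝒳 => f p.1 p.2 := by
  have h1 : Measurable fun p : 𝒳 × 𝒳 => ∫ y, y ∂(Q p) :=
    (StronglyMeasurable.integral_kernel (κ := Q) stronglyMeasurable_id).measurable
  convert h1 using 2 with p
  exact ((hQ p.1 p.2).1).symm

/-! ### Measurability and integrability of the conditional mean. -/

section Measurability

variable {d n : ℕ} {𝒳 : Set (E d)} {K : E d → ℝ} {M κ R r β L h lam ν τ : ℝ}
  {Q : Kernel (𝒳 × 𝒳) ℝ} {f : 𝒳 → 𝒳 → ℝ}

lemma KernelBounds.measurable_scaledKernel_sub (hK : KernelBounds K M κ R r) (x : E d) :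
    Measurable fun y : 𝒳 => scaledKernel K h (x - (y : E d)) := by
  have := hK.measurable
  unfold scaledKernel
  fun_prop

lemma KernelBounds.measurable_kernelWeight (hK : KernelBounds K M κ R r) (x x' : 𝒳)
    (p : Fin n × Fin n) : Measurable fun X : Fin n → 𝒳 => kernelWeight K h x x' X p :=
  ((hK.measurable_scaledKernel_sub (x : E d)).comp (measurable_pi_apply p.1)).mul
    ((hK.measurable_scaledKernel_sub (x' : E d)).comp (measurable_pi_apply p.2))

lemma KernelBounds.measurable_totalWeight (hK : KernelBounds K M κ R r) (x x' : 𝒳) :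
    Measurable fun X : Fin n → 𝒳 => totalWeight K h lam x x' X :=
  Finset.measurable_sum _ fun p _ => (hK.measurable_kernelWeight x x' p).add_const lam

lemma KernelBounds.measurable_meanWeight (hK : KernelBounds K M κ R r) (x x' : 𝒳) :
    Measurable fun X : Fin n → 𝒳 => meanWeight K h lam x x' X :=
  (hK.measurable_totalWeight x x').const_mul _

lemma KernelBounds.measurable_pairCoeff (hK : KernelBounds K M κ R r) (x x' : 𝒳) (q : Pair n) :
    Measurable fun X : Fin n → 𝒳 => pairCoeff K h lam x x' X q :=
  (((hK.measurable_kernelWeight x x' _).add_const lam).add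
    ((hK.measurable_kernelWeight x x' _).add_const lam)).div (hK.measurable_totalWeight x x')

lemma measurable_condMean (hK : KernelBounds K M κ R r) (hQ : HasMeanAndVarianceLT Q f τ)
    (x x' : 𝒳) : Measurable fun X : Fin n → 𝒳 => condMean K h lam x x' f X := by
  refine Measurable.div (Finset.measurable_sum _ fun p _ => ?_) (hK.measurable_totalWeight x x')
  have h1 : Measurable fun X : Fin n → 𝒳 => (X p.1, X p.2) := by fun_prop
  exact ((hK.measurable_kernelWeight x x' p).add_const lam).mul (hQ.measurable.comp h1)

lemma abs_condMean_le (hK : KernelBounds K M κ R r) (H : Tuning d n h lam ν)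
    (hf : f ∈ holderClass 𝒳 β L) (x x' : 𝒳) (X : Fin n → 𝒳) :
    |condMean K h lam x x' f X| ≤ 3 * L := by
  have h1 := abs_condMean_sub_le_two_mul hK H hf x x' X
  have h2 := hf.2.2 x x'
  rw [abs_le] at *
  constructor <;> linarith [h1.1, h1.2, h2.1, h2.2]

lemma integrable_condMean (μ : Measure (Fin n → 𝒳)) [IsProbabilityMeasure μ]
    (hK : KernelBounds K M κ R r) (H : Tuning d n h lam ν) (hf : f ∈ holderClass 𝒳 β L) (hQ : HasMeanAndVarianceLT Q f τ) (x x' : 𝒳) :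
    Integrable (condMean K h lam x x' f) μ :=
  .of_bound (measurable_condMean hK hQ x x').aestronglyMeasurable (3 * L)
    (.of_forall fun X => abs_condMean_le hK H hf x x' X)

end Measurability

/-! ### Conditional moments of the smoother given the covariates. -/

section ConditionalLaw

variable {d n : ℕ} {𝒳 : Set (E d)} {K : E d → ℝ} {M κ R r β L h lam ν τ : ℝ}
  {Q : Kernel (𝒳 × 𝒳) ℝ} [IsMarkovKernel Q] {f : 𝒳 → 𝒳 → ℝ}

lemma outcomeKernel_apply (X : Fin n → 𝒳) :
    outcomeKernel n Q X = Measure.pi fun p : Pair n => Q (X p.1.1, X p.1.2) := rfl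

instance : IsMarkovKernel (outcomeKernel n Q) :=
  ⟨fun X => by rw [outcomeKernel_apply]; infer_instance⟩

instance (μ : Measure (Fin n → 𝒳)) [IsProbabilityMeasure μ] :
    IsProbabilityMeasure (dataLaw μ Q) := by
  rw [dataLaw]; infer_instance

lemma HasMeanAndVarianceLT.memLp (hQ : HasMeanAndVarianceLT Q f τ) (a b : 𝒳) :
    MemLp id 2 (Q (a, b)) :=
  (evariance_lt_top_iff_memLp measurable_id.aestronglyMeasurable).1
    ((hQ a b).2.trans ENNReal.ofReal_lt_top)

lemma HasMeanAndVarianceLT.variance_le (hQ : HasMeanAndVarianceLT Q f τ) (hτ : 0 ≤ τ)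
    (a b : 𝒳) : Var[id; Q (a, b)] ≤ τ := by
  have := (hQ a b).2.le
  rw [← (hQ.memLp a b).ofReal_variance_eq] at this
  exact (ENNReal.ofReal_le_ofReal_iff hτ).1 this

lemma measurable_smoother (hK : KernelBounds K M κ R r) (H : Tuning d n h lam ν) (x x' : 𝒳) :
    Measurable (smoother (n := n) K h lam x x') := by
  have h1 : smoother (n := n) K h lam x x' =
      fun ω => ∑ q, pairCoeff K h lam x x' ω.1 q * ω.2 q :=
    funext fun ω => smoother_eq_sum H x x' ω.1 ω.2
  rw [h1]
  refine Finset.measurable_sum _ fun q _ => ?_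
  exact ((hK.measurable_pairCoeff x x' q).comp measurable_fst).mul
    ((measurable_pi_apply q).comp measurable_snd)

lemma memLp_pairCoeff_mul (hQ : HasMeanAndVarianceLT Q f τ) (x x' : 𝒳) (X : Fin n → 𝒳)
    (q : Pair n) :
    MemLp (fun y : ℝ => pairCoeff K h lam x x' X q * y) 2 (Q (X q.1.1, X q.1.2)) :=
  (hQ.memLp _ _).const_mul _

lemma memLp_smoother_section (H : Tuning d n h lam ν) (hQ : HasMeanAndVarianceLT Q f τ)
    (x x' : 𝒳) (X : Fin n → 𝒳) :
    MemLp (fun Y => smoother K h lam x x' (X, Y)) 2 (outcomeKernel n Q X) := by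
  simp only [smoother_eq_sum H, outcomeKernel_apply]
  exact memLp_finsetSum _ fun q _ => (memLp_pairCoeff_mul hQ x x' X q).comp_measurePreserving
    (measurePreserving_eval (fun p : Pair n => Q (X p.1.1, X p.1.2)) q)

lemma integral_smoother_section (H : Tuning d n h lam ν) (hf : f ∈ holderClass 𝒳 β L)
    (hQ : HasMeanAndVarianceLT Q f τ) (x x' : 𝒳) (X : Fin n → 𝒳) :
    ∫ Y, smoother K h lam x x' (X, Y) ∂(outcomeKernel n Q X) = condMean K h lam x x' f X := by
  simp only [smoother_eq_sum H, outcomeKernel_apply]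
  rw [integral_finsetSum, ← sum_pairCoeff_mul x x' hf.1]
  · refine Finset.sum_congr rfl fun q _ => ?_
    have h1 := integral_comp_eval (μ := fun p : Pair n => Q (X p.1.1, X p.1.2)) (i := q)
      (f := fun y : ℝ => y) measurable_id.aestronglyMeasurable
    rw [integral_const_mul, h1, (hQ _ _).1]
  · exact fun q _ => ((memLp_pairCoeff_mul hQ x x' X q).comp_measurePreserving
      (measurePreserving_eval (fun p : Pair n => Q (X p.1.1, X p.1.2)) q)).integrable one_le_two

/-- Independence makes the variance additive over unordered pairs. -/
lemma variance_smoother_section_le (H : Tuning d n h lam ν) (hτ : 0 ≤ τ)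
    (hQ : HasMeanAndVarianceLT Q f τ) (x x' : 𝒳) (X : Fin n → 𝒳) :
    Var[fun Y => smoother K h lam x x' (X, Y); outcomeKernel n Q X] ≤
      τ * ∑ q, pairCoeff K h lam x x' X q ^ 2 := by
  have h1 : (fun Y => smoother K h lam x x' (X, Y)) =
      ∑ q, fun Y : Pair n → ℝ => pairCoeff K h lam x x' X q * Y q := by
    ext Y
    simp [smoother_eq_sum H]
  rw [h1, outcomeKernel_apply, variance_sum_pi
    (X := fun q y => pairCoeff K h lam x x' X q * y) (memLp_pairCoeff_mul hQ x x' X),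
    Finset.mul_sum]
  refine Finset.sum_le_sum fun q _ => ?_
  rw [mul_comm τ, variance_const_mul]
  exact mul_le_mul_of_nonneg_left (hQ.variance_le hτ _ _) (sq_nonneg _)

lemma integral_sq_smoother_section_le (hK : KernelBounds K M κ R r) (H : Tuning d n h lam ν)
    (hτ : 0 ≤ τ) (hf : f ∈ holderClass 𝒳 β L) (hQ : HasMeanAndVarianceLT Q f τ) (x x' : 𝒳)
    (X : Fin n → 𝒳) :
    ∫ Y, smoother K h lam x x' (X, Y) ^ 2 ∂(outcomeKernel n Q X) ≤ τ + (3 * L) ^ 2 := by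
  have h1 := variance_eq_sub (memLp_smoother_section (K := K) H hQ x x' X)
  have h2 := variance_smoother_section_le (K := K) H hτ hQ x x' X
  have h3 := mul_le_mul_of_nonneg_left (sum_sq_pairCoeff_le_one hK H x x' X) hτ
  rw [integral_smoother_section H hf hQ] at h1
  have h4 := sq_le_sq' (abs_le.1 (abs_condMean_le hK H hf x x' X)).1
    (abs_le.1 (abs_condMean_le hK H hf x x' X)).2
  simp only [Pi.pow_apply] at h1
  linarith

variable (μ : Measure (Fin n → 𝒳)) [IsProbabilityMeasure μ]

/-- The smoother is square integrable, whatever the law of the covariates. -/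
lemma memLp_smoother (hK : KernelBounds K M κ R r) (H : Tuning d n h lam ν) (hτ : 0 ≤ τ)
    (hf : f ∈ holderClass 𝒳 β L) (hQ : HasMeanAndVarianceLT Q f τ) (x x' : 𝒳) :
    MemLp (smoother K h lam x x') 2 (dataLaw μ Q) := by
  have hm := measurable_smoother (n := n) hK H x x'
  rw [memLp_two_iff_integrable_sq hm.aestronglyMeasurable]
  refine ⟨(hm.pow_const 2).aestronglyMeasurable, ?_⟩
  rw [hasFiniteIntegral_iff_enorm, dataLaw,
    Measure.lintegral_compProd (hm.pow_const 2).enorm]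
  refine lt_of_le_of_lt (lintegral_mono (g := fun _ => ENNReal.ofReal (τ + (3 * L) ^ 2))
    fun X => ?_) (by simp)
  have hint := (memLp_smoother_section (K := K) H hQ x x' X).integrable_sq
  rw [← ofReal_integral_norm_eq_lintegral_enorm hint]
  simp only [norm_pow, Real.norm_eq_abs, sq_abs]
  exact ENNReal.ofReal_le_ofReal (integral_sq_smoother_section_le hK H hτ hf hQ x x' X)

lemma covariateSigma_le : covariateSigma 𝒳 n ≤ Prod.instMeasurableSpace :=
  measurable_fst.comap_le

/-- Given the covariates, the conditional expectation is the integral against the outcome law. -/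
lemma condExp_dataLaw {F : (Fin n → 𝒳) × (Pair n → ℝ) → ℝ} (hF : Integrable F (dataLaw μ Q))
    {G : (Fin n → 𝒳) → ℝ} (hG : Measurable G) (hGi : Integrable G μ)
    (hFG : ∀ X, ∫ Y, F (X, Y) ∂(outcomeKernel n Q X) = G X) :
    (dataLaw μ Q)[F | covariateSigma 𝒳 n] =ᵐ[dataLaw μ Q] fun ω => G ω.1 := by
  have hfst : (dataLaw μ Q).map Prod.fst = μ := by
    simpa [Measure.fst, dataLaw] using Measure.fst_compProd μ (outcomeKernel n Q)
  have hGi' : Integrable (fun ω : (Fin n → 𝒳) × (Pair n → ℝ) => G ω.1) (dataLaw μ Q) := by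
    rw [← hfst] at hGi
    exact hGi.comp_measurable measurable_fst
  refine (ae_eq_condExp_of_forall_setIntegral_eq covariateSigma_le hF
    (fun s _ _ => hGi'.integrableOn) ?_ ?_).symm
  · rintro _ ⟨s, hs, rfl⟩ -
    -- The sets generated by the covariates are cylinders, so both set integrals disintegrate over
    -- the outcome kernel.
    have hpre : (Prod.fst ⁻¹' s : Set ((Fin n → 𝒳) × (Pair n → ℝ))) = s ×ˢ Set.univ := by
      ext; simp
    rw [hpre, dataLaw, Measure.setIntegral_compProd hs MeasurableSet.univ hF.integrableOn,
      Measure.setIntegral_compProd hs MeasurableSet.univ hGi'.integrableOn]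
    simp [hFG]
  · exact (hG.comp (comap_measurable _)).stronglyMeasurable.aestronglyMeasurable

lemma condExp_smoother (hK : KernelBounds K M κ R r) (H : Tuning d n h lam ν) (hτ : 0 ≤ τ)
    (hf : f ∈ holderClass 𝒳 β L) (hQ : HasMeanAndVarianceLT Q f τ) (x x' : 𝒳) :
    (dataLaw μ Q)[smoother K h lam x x' | covariateSigma 𝒳 n] =ᵐ[dataLaw μ Q]
      fun ω => condMean K h lam x x' f ω.1 :=
  condExp_dataLaw μ ((memLp_smoother μ hK H hτ hf hQ x x').integrable one_le_two)
    (measurable_condMean hK hQ x x') (integrable_condMean μ hK H hf hQ x x')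
    (integral_smoother_section H hf hQ x x')

lemma integral_smoother (hK : KernelBounds K M κ R r) (H : Tuning d n h lam ν) (hτ : 0 ≤ τ)
    (hf : f ∈ holderClass 𝒳 β L) (hQ : HasMeanAndVarianceLT Q f τ) (x x' : 𝒳) :
    ∫ ω, smoother K h lam x x' ω ∂(dataLaw μ Q) = ∫ X, condMean K h lam x x' f X ∂μ := by
  rw [dataLaw, Measure.integral_compProd
    ((memLp_smoother μ hK H hτ hf hQ x x').integrable one_le_two)]
  simp only [integral_smoother_section H hf hQ]

/-- The outer expectation removes the conditioning from the squared residual; disintegrating then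
recovers the variance in each section. -/
lemma integral_condVar_smoother (hK : KernelBounds K M κ R r) (H : Tuning d n h lam ν)
    (hτ : 0 ≤ τ) (hf : f ∈ holderClass 𝒳 β L) (hQ : HasMeanAndVarianceLT Q f τ) (x x' : 𝒳) :
    ∫ ω, condVar (covariateSigma 𝒳 n) (smoother K h lam x x') (dataLaw μ Q) ω ∂(dataLaw μ Q) =
      ∫ X, Var[fun Y => smoother K h lam x x' (X, Y); outcomeKernel n Q X] ∂μ := by
  have hLp := memLp_smoother μ hK H hτ hf hQ x x'
  have hce := condExp_smoother μ hK H hτ hf hQ x x'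
  unfold condVar
  rw [integral_condExp covariateSigma_le]
  have hae : (smoother K h lam x x' -
      (dataLaw μ Q)[smoother K h lam x x' | covariateSigma 𝒳 n]) ^ 2 =ᵐ[dataLaw μ Q]
      fun ω => (smoother K h lam x x' ω - condMean K h lam x x' f ω.1) ^ 2 := by
    filter_upwards [hce] with ω hω
    simp [hω]
  have hi : Integrable ((smoother K h lam x x' -
      (dataLaw μ Q)[smoother K h lam x x' | covariateSigma 𝒳 n]) ^ 2) (dataLaw μ Q) :=
    (hLp.sub (hLp.condExp one_le_two)).integrable_sq
  rw [integral_congr_ae hae, dataLaw, Measure.integral_compProd]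
  · refine integral_congr_ae (.of_forall fun X => ?_)
    dsimp only
    rw [variance_eq_integral (memLp_smoother_section (K := K) H hQ x x' X).1.aemeasurable,
      integral_smoother_section H hf hQ]
  · exact hi.congr hae

end ConditionalLaw

/-! ### From the size of the low-weight event to the three terms. -/

/-- A nonnegative function which is small off a set and bounded has small integral if the set has
small probability. -/
lemma integral_le_add_mul_measureReal {α : Type*} [MeasurableSpace α] (μ : Measure α)
    [IsProbabilityMeasure μ] {g : α → ℝ} {s : Set α} (hs : MeasurableSet s) {a b : ℝ}
    (h0 : ∀ x, 0 ≤ g x) (hb : ∀ x, g x ≤ b) (ha : ∀ x ∉ s, g x ≤ a) (ha0 : 0 ≤ a) :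
    ∫ x, g x ∂μ ≤ a + b * μ.real s := by
  have hi : Integrable (s.indicator fun _ => b) μ := (integrable_const b).indicator hs
  calc ∫ x, g x ∂μ ≤ ∫ x, (a + s.indicator (fun _ => b) x) ∂μ := by
        refine integral_mono_of_nonneg (.of_forall h0) ((integrable_const a).add hi)
          (.of_forall fun x => ?_)
        by_cases hx : x ∈ s
        · simp only [hx, Set.indicator_of_mem]; linarith [hb x]
        · simpa [hx] using ha x hx
    _ = a + b * μ.real s := by
        rw [integral_add (integrable_const a) hi, integral_indicator_const _ hs]
        simp [mul_comm]

lemma sq_integral_le {α : Type*} [MeasurableSpace α] (μ : Measure α) [IsProbabilityMeasure μ]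
    {g : α → ℝ} (hg : MemLp g 2 μ) : (∫ x, g x ∂μ) ^ 2 ≤ ∫ x, g x ^ 2 ∂μ := by
  have h1 := variance_eq_sub hg
  have h2 := variance_nonneg g μ
  simp only [Pi.pow_apply] at h1
  linarith

section Terms

variable {d n : ℕ} {𝒳 : Set (E d)} {K : E d → ℝ} {M κ R r β L h lam ν τ v D : ℝ}
  (μ : Measure (Fin n → 𝒳)) [IsProbabilityMeasure μ]
  {Q : holderClass 𝒳 β L → Kernel (𝒳 × 𝒳) ℝ} [∀ f, IsMarkovKernel (Q f)]

/-- The covariates for which the denominator of the smoother is smaller than `v`. -/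
def lowWeightSet (n : ℕ) (K : E d → ℝ) (h lam v : ℝ) (x x' : 𝒳) : Set (Fin n → 𝒳) :=
  {X | meanWeight K h lam x x' X < v}

lemma KernelBounds.measurableSet_lowWeightSet (hK : KernelBounds K M κ R r) (x x' : 𝒳) :
    MeasurableSet (lowWeightSet n K h lam v x x') :=
  measurableSet_lt (hK.measurable_meanWeight x x') measurable_const

/-- Jensen moves the square inside the expectation. The low-weight event contributes at most
$(2L)^2$ times its probability. -/
lemma rho1_le (hK : KernelBounds K M κ R r) (H : Tuning d n h lam ν) (hL : 0 ≤ L) (hτ : 0 ≤ τ)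
    (hβ0 : 0 ≤ β) (hβ1 : β ≤ 1) (hQ : ∀ f, HasMeanAndVarianceLT (Q f) f.1 τ) (x x' : 𝒳)
    (hv : 0 < v) (hμ : μ.real (lowWeightSet n K h lam v x x') ≤ D * h ^ (2 * β)) :
    rho1 μ Q K h lam x x' ≤
      ENNReal.ofReal (((2 * L * R + 2 * L / v) ^ 2 + (2 * L) ^ 2 * D) * h ^ (2 * β)) := by
  refine iSup_le fun f => ENNReal.ofReal_le_ofReal ?_
  have hm := measurable_condMean (n := n) (h := h) (lam := lam) hK (hQ f) x x'
  have hi := integrable_condMean μ hK H f.2 (hQ f) x x'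
  have hLp : MemLp (fun X => condMean K h lam x x' f.1 X - f.1 x x') 2 μ :=
    .of_bound (hm.sub_const _).aestronglyMeasurable (2 * L)
      (.of_forall fun X => abs_condMean_sub_le_two_mul hK H f.2 x x' X)
  have h1 : ∫ X, (condMean K h lam x x' f.1 X - f.1 x x') ∂μ =
      (∫ X, condMean K h lam x x' f.1 X ∂μ) - f.1 x x' := by
    rw [integral_sub hi (integrable_const _)]
    simp
  rw [integral_smoother μ hK H hτ f.2 (hQ f), abs_sub_comm, ← h1, sq_abs]
  refine (sq_integral_le μ hLp).trans ((integral_le_add_mul_measureReal μ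
    (b := (2 * L) ^ 2) (a := ((2 * L * R + 2 * L / v) * h ^ β) ^ 2)
    (hK.measurableSet_lowWeightSet (lam := lam) (h := h) (v := v) x x') (fun _ => sq_nonneg _)
    (fun X => ?_) (fun X hX => ?_) (sq_nonneg _)).trans ?_)
  · have := abs_condMean_sub_le_two_mul hK H f.2 x x' X
    exact sq_le_sq' (abs_le.1 this).1 (abs_le.1 this).2
  · have := abs_condMean_sub_le hK H hL hβ0 hβ1 f.2 x x' X hv (not_lt.1 hX)
    exact sq_le_sq' (abs_le.1 this).1 (abs_le.1 this).2
  · rw [H.rpow_two_mul] at *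
    have := mul_le_mul_of_nonneg_left hμ (sq_nonneg (2 * L))
    linarith

/-- On the low-weight event the coefficients still form a probability vector, so the conditional
variance is at most $\tau$. -/
lemma rho2_le (hK : KernelBounds K M κ R r) (H : Tuning d n h lam ν) (hτ : 0 ≤ τ)
    (hQ : ∀ f, HasMeanAndVarianceLT (Q f) f.1 τ) (x x' : 𝒳)
    (hv : 0 < v)
    (hμ : μ.real (lowWeightSet n K h lam v x x') ≤ D * (((n : ℝ) * h ^ d) ^ 2)⁻¹) :
    rho2 μ Q K h lam x x' ≤
      ENNReal.ofReal ((8 * M ^ 2 / v * τ + τ * D) * (((n : ℝ) * h ^ d) ^ 2)⁻¹) := by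
  refine iSup_le fun f => ENNReal.ofReal_le_ofReal ?_
  have hs := H.nh_pos
  rw [integral_condVar_smoother μ hK H hτ f.2 (hQ f)]
  refine (integral_le_add_mul_measureReal μ (b := τ)
    (a := τ * (8 * M ^ 2 / v * (((n : ℝ) * h ^ d) ^ 2)⁻¹))
    (hK.measurableSet_lowWeightSet (lam := lam) (h := h) (v := v) x x')
    (fun _ => variance_nonneg _ _) (fun X => ?_) (fun X hX => ?_) (by positivity)).trans ?_
  · refine (variance_smoother_section_le H hτ (hQ f) x x' X).trans ?_
    exact (mul_le_mul_of_nonneg_left (sum_sq_pairCoeff_le_one hK H x x' X) hτ).trans_eq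
      (mul_one τ)
  · refine (variance_smoother_section_le H hτ (hQ f) x x' X).trans ?_
    exact mul_le_mul_of_nonneg_left (sum_sq_pairCoeff_le hK H x x' X hv (not_lt.1 hX)) hτ
  · have := mul_le_mul_of_nonneg_left hμ hτ
    linarith

/-- The third term only involves the variance of the conditional mean of the smoother. -/
lemma rho3_eq (hK : KernelBounds K M κ R r) (H : Tuning d n h lam ν) (hτ : 0 ≤ τ)
    (hQ : ∀ f, HasMeanAndVarianceLT (Q f) f.1 τ) (x x' : 𝒳) :
    rho3 μ Q K h lam x x' =
      ⨆ f : holderClass 𝒳 β L, ENNReal.ofReal Var[condMean K h lam x x' f.1; μ] := by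
  refine iSup_congr fun f => ?_
  have hm := measurable_condMean (n := n) (h := h) (lam := lam) hK (hQ f) x x'
  have hfst : (dataLaw μ (Q f)).map Prod.fst = μ := by
    simpa [Measure.fst, dataLaw] using Measure.fst_compProd μ (outcomeKernel n (Q f))
  have hce : (fun ω => f.1 x x' -
      ((dataLaw μ (Q f))[smoother K h lam x x' | covariateSigma 𝒳 n]) ω) =ᵐ[dataLaw μ (Q f)]
      fun ω => f.1 x x' - condMean K h lam x x' f.1 ω.1 := by
    filter_upwards [condExp_smoother μ hK H hτ f.2 (hQ f) x x'] with ω hω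
    rw [hω]
  have hLp : MemLp (fun ω : (Fin n → 𝒳) × (Pair n → ℝ) =>
      f.1 x x' - condMean K h lam x x' f.1 ω.1) 2 (dataLaw μ (Q f)) :=
    .of_bound ((hm.comp measurable_fst).const_sub _).aestronglyMeasurable (2 * L)
      (.of_forall fun ω => by
        rw [norm_sub_rev]; exact abs_condMean_sub_le_two_mul hK H f.2 x x' ω.1)
  rw [evariance_congr hce, ← hLp.ofReal_variance_eq,
    variance_const_sub (X := fun ω : (Fin n → 𝒳) × (Pair n → ℝ) =>
      condMean K h lam x x' f.1 ω.1) (hm.comp measurable_fst).aestronglyMeasurable]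
  congr 1
  conv_rhs => rw [← hfst]
  rw [variance_map hm.aemeasurable measurable_fst.aemeasurable]
  rfl

end Terms

/-! ### Lower bound on the denominator in the fixed design. -/

section FixedDesign

variable {d n : ℕ} {𝒳 : Set (E d)} {K : E d → ℝ} {M κ R r β L h lam ν τ v c₀ cX CX : ℝ}

/-- The volume of the Euclidean unit ball. -/
def unitBallVolume (d : ℕ) : ℝ := (volume : Measure (E d)).real (Metric.ball 0 1)

lemma unitBallVolume_pos (d : ℕ) : 0 < unitBallVolume d :=
  ENNReal.toReal_pos (Metric.measure_ball_pos volume 0 one_pos).ne' measure_ball_lt_top.ne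

lemma volume_closedBall_eq (x : E d) {a : ℝ} (ha : 0 ≤ a) :
    volume (Metric.closedBall x a) = ENNReal.ofReal (a ^ d * unitBallVolume d) := by
  rw [Measure.addHaar_closedBall _ _ ha, ENNReal.ofReal_mul (by positivity), unitBallVolume,
    ofReal_measureReal measure_ball_lt_top.ne]
  simp

/-- In the fixed design a ball of radius of order `h` contains of order `n h ^ d` covariates. -/
lemma IsFixedDesign.le_card_nearIndices (H : Tuning d n h lam ν) (hr : 0 < r) (hr1 : r ≤ 1)
    (hCX : 0 < CX) {X : Fin n → 𝒳} (hX : IsFixedDesign cX CX X)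
    {x : 𝒳} (hx : VolumeRegularAt 𝒳 c₀ (x : E d)) (hs : (2 * CX / r) ^ d ≤ (n : ℝ) * h ^ d) :
    c₀ * (r / 2) ^ d / (CX ^ d * unitBallVolume d) * ((n : ℝ) * h ^ d) ≤
      (nearIndices (r * h) x X).card := by
  have hn := H.n_pos
  have hh := H.h_pos
  have hd := H.one_le_d
  have hω := unitBallVolume_pos d
  set a : ℝ := CX / (n : ℝ) ^ (1 / (d : ℝ)) with ha_def
  have ha : 0 < a := by positivity
  have had : a ^ d = CX ^ d / n := by
    rw [ha_def, div_pow, ← Real.rpow_natCast ((n : ℝ) ^ (1 / (d : ℝ))), ← Real.rpow_mul hn.le,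
      one_div_mul_cancel (by positivity), Real.rpow_one]
  -- After raising to the power $d$ this is `hs`.
  have h2a : 2 * a ≤ r * h := by
    rw [← pow_le_pow_iff_left₀ (by positivity) (by positivity) (by omega : d ≠ 0), mul_pow, had,
      mul_pow r, ← mul_div_assoc, ← mul_pow, div_le_iff₀ hn]
    rw [div_pow, div_le_iff₀ (by positivity)] at hs
    linarith
  -- Halving the radius leaves room: a covariate within $a\le rh/2$ of a point of this ball is
  -- within $rh$ of $x$. Comparing volumes then bounds the number of covariates from below.
  have hsub : 𝒳 ∩ Metric.closedBall (x : E d) (r * h / 2) ⊆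
      ⋃ i ∈ nearIndices (r * h) x X, Metric.closedBall (X i : E d) a := by
    rintro y ⟨hy, hyx⟩
    obtain ⟨j, hj⟩ := hX.2 ⟨y, hy⟩
    rw [mem_closedBall_iff_norm'] at hyx
    refine Set.mem_biUnion (x := j) ?_ (by rw [mem_closedBall_iff_norm]; exact hj)
    simp only [nearIndices, Finset.mem_coe, Finset.mem_filter, Finset.mem_univ, true_and]
    have := norm_sub_le_norm_sub_add_norm_sub (x : E d) y (X j : E d)
    have hj' : ‖y - (X j : E d)‖ ≤ a := hj
    linarith
  have hvol : ENNReal.ofReal (c₀ * (r * h / 2) ^ d) ≤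
      ENNReal.ofReal ((nearIndices (r * h) x X).card * (a ^ d * unitBallVolume d)) := by
    refine (hx (r * h / 2) (by positivity) ?_).trans ((measure_mono hsub).trans
      ((measure_biUnion_finset_le _ _).trans_eq ?_))
    · have := mul_le_one₀ hr1 hh.le H.h_le_one
      linarith
    · simp only [volume_closedBall_eq _ ha.le]
      rw [Finset.sum_const, nsmul_eq_mul, ENNReal.ofReal_mul (Nat.cast_nonneg _),
        ENNReal.ofReal_natCast]
  rw [ENNReal.ofReal_le_ofReal_iff (by positivity), had] at hvol
  have e : r * h / 2 = r / 2 * h := by ring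
  rw [e, mul_pow] at hvol
  rw [div_mul_eq_mul_div, div_le_iff₀ (by positivity)]
  calc c₀ * (r / 2) ^ d * ((n : ℝ) * h ^ d) = n * (c₀ * ((r / 2) ^ d * h ^ d)) := by ring
    _ ≤ n * ((nearIndices (r * h) x X).card * (CX ^ d / n * unitBallVolume d)) := by gcongr
    _ = _ := by field_simp

/-- In the fixed design the denominator of the smoother can only be small if `n h ^ d` is
bounded. -/
lemma IsFixedDesign.exists_measureReal_lowWeightSet_le (hK : KernelBounds K M κ R r)
    (hν : 0 < ν) (hCX : 0 < CX) (hc₀ : 0 < c₀) :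
    ∃ v > 0, ∃ D ≥ 0, ∀ (n : ℕ) (h lam : ℝ), Tuning d n h lam ν → ∀ X : Fin n → 𝒳,
      IsFixedDesign cX CX X → ∀ x x' : 𝒳, VolumeRegularAt 𝒳 c₀ (x : E d) →
      VolumeRegularAt 𝒳 c₀ (x' : E d) →
      (Measure.dirac X).real (lowWeightSet n K h lam v x x') ≤
        D * (((n : ℝ) * h ^ d) ^ (2 * ν + 2))⁻¹ := by
  set δ : ℝ := c₀ * (r / 2) ^ d / (CX ^ d * unitBallVolume d)
  have hr := hK.r_pos
  have hκ := hK.κ_pos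
  have hω := unitBallVolume_pos d
  have hδ : 0 < δ := by positivity
  -- Above this threshold both the covering bound and `le_meanWeight` apply, and the denominator is
  -- not small. Below it, $D=A^{2\nu+2}$ makes the claimed bound at least one.
  set A : ℝ := max ((2 * CX / r) ^ d) (2 / δ)
  have hA : 0 < A := lt_max_of_lt_right (by positivity)
  refine ⟨κ ^ 2 * δ ^ 2 / 2, by positivity, A ^ (2 * ν + 2), by positivity,
    fun n h lam H X hX x x' hx hx' => ?_⟩
  have hs := H.nh_pos
  rcases le_or_gt A ((n : ℝ) * h ^ d) with hA' | hA'
  · have h1 := (le_max_left _ _).trans hA'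
    have h2 : 2 ≤ δ * ((n : ℝ) * h ^ d) := by
      rw [← div_le_iff₀' hδ]
      exact (le_max_right _ _).trans hA'
    have hV := le_meanWeight hK H h2 (hX.le_card_nearIndices H hr hK.r_le_one hCX hx h1)
      (hX.le_card_nearIndices H hr hK.r_le_one hCX hx' h1)
    rw [measureReal_def, Measure.dirac_apply' _ (hK.measurableSet_lowWeightSet x x'),
      Set.indicator_of_notMem (by exact not_lt.2 hV)]
    simp only [ENNReal.toReal_zero]
    positivity
  · refine measureReal_le_one.trans ?_
    rw [← div_eq_mul_inv, one_le_div (by positivity)]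
    exact Real.rpow_le_rpow hs.le hA'.le (by positivity)

end FixedDesign

/-! ### Concentration of the denominator in the random design. -/

open Classical in
/-- Chernoff bound for the lower tail of the number of i.i.d. points that fall into a set. -/
lemma measureReal_card_lt_le {α : Type*} [MeasurableSpace α] (P : Measure α)
    [IsProbabilityMeasure P] {A : Set α} (hA : MeasurableSet A) (n : ℕ) :
    (Measure.pi fun _ : Fin n => P).real
      {X | ((Finset.univ.filter fun i => X i ∈ A).card : ℝ) < n * P.real A / 4} ≤
      Real.exp (-(n * P.real A / 4)) := by
  set p := P.real A
  have hp1 : p ≤ 1 := measureReal_le_one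
  have hp0 : 0 ≤ p := measureReal_nonneg
  -- This is $e^{-1_A}$, so the product of its values over the sample is $e^{-N}$, with $N$ the
  -- number of points in $A$. Since $1-e^{-1}\ge1/2$, its mean is at most $1-p/2\le e^{-p/2}$.
  set g : α → ℝ := fun y => 1 - A.indicator (fun _ => 1 - Real.exp (-1)) y
  have hg : ∀ y, g y = if y ∈ A then Real.exp (-1) else 1 := fun y => by
    by_cases hy : y ∈ A <;> simp [g, hy]
  have he : Real.exp (-1) ≤ 1 / 2 := by
    rw [Real.exp_neg, one_div]
    refine inv_anti₀ two_pos ?_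
    have := Real.add_one_le_exp (1 : ℝ)
    linarith
  have hgi : ∫ y, g y ∂P ≤ Real.exp (-(p / 2)) := by
    have h1 : ∫ y, g y ∂P = 1 - p * (1 - Real.exp (-1)) := by
      rw [integral_sub (integrable_const _) ((integrable_const _).indicator hA),
        integral_indicator_const _ hA]
      simp [p]
    have h2 := Real.add_one_le_exp (-(p / 2))
    rw [h1]
    nlinarith
  have hprod : ∀ X : Fin n → α, ∏ i, g (X i) =
      Real.exp (-((Finset.univ.filter fun i => X i ∈ A).card : ℝ)) := fun X => by
    simp only [hg]
    rw [Finset.prod_ite, Finset.prod_const, Finset.prod_const_one, mul_one, ← Real.exp_nat_mul]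
    ring_nf
  have hgm : Measurable g := measurable_const.sub (measurable_const.indicator hA)
  have hg0 : ∀ y, 0 ≤ g y := fun y => by rw [hg]; split_ifs <;> positivity
  have hg1 : ∀ y, g y ≤ 1 := fun y => by
    rw [hg]; split_ifs
    · linarith
    · exact le_rfl
  have hint : Integrable (fun X : Fin n → α => ∏ i, g (X i)) (Measure.pi fun _ => P) :=
    Integrable.fintype_prod (f := fun _ => g) fun _ => .of_bound hgm.aestronglyMeasurable 1
      (.of_forall fun y => by rw [Real.norm_of_nonneg (hg0 y)]; exact hg1 y)
  -- Markov at level $e^{-np/4}$ against the mean bound $e^{-np/2}$ leaves $e^{-np/4}$.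
  have hmarkov := mul_meas_ge_le_integral_of_nonneg
    (.of_forall fun X => Finset.prod_nonneg fun i _ => hg0 (X i)) hint
    (Real.exp (-(n * p / 4)))
  rw [integral_fintype_prod_eq_prod (fun _ => g)] at hmarkov
  simp only [Finset.prod_const, Finset.card_univ, Fintype.card_fin] at hmarkov
  have hpow : (∫ y, g y ∂P) ^ n ≤ Real.exp (-(n * p / 4)) * Real.exp (-(n * p / 4)) := by
    refine (pow_le_pow_left₀ (integral_nonneg hg0) hgi n).trans_eq ?_
    rw [← Real.exp_nat_mul, ← Real.exp_add]
    ring_nf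
  refine (measureReal_mono fun X hX => ?_).trans
    (le_of_mul_le_mul_left (hmarkov.trans hpow) (Real.exp_pos _))
  change _ ≤ ∏ i, g (X i)
  rw [hprod, Real.exp_le_exp]
  exact neg_le_neg (le_of_lt hX)

section RandomDesign

variable {d n : ℕ} {𝒳 : Set (E d)} {K : E d → ℝ} {M κ R r β L h lam ν τ v c₀ l u : ℝ} {m : 𝒳 → ℝ}

lemma measurableSet_near (a : ℝ) (x : 𝒳) : MeasurableSet {y : 𝒳 | ‖(x : E d) - (y : E d)‖ ≤ a} :=
  measurableSet_le (by fun_prop) measurable_const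

lemma IsDesignDensity.le_measureReal_near (h𝒳 : MeasurableSet 𝒳) (hm : IsDesignDensity l u m)
    (hl : 0 ≤ l) {x : 𝒳} (hx : VolumeRegularAt 𝒳 c₀ (x : E d)) {a : ℝ} (ha0 : 0 < a)
    (ha1 : a ≤ 1) :
    l * (c₀ * a ^ d) ≤ (marginalLaw m).real {y : 𝒳 | ‖(x : E d) - (y : E d)‖ ≤ a} := by
  have := hm.isProbabilityMeasure
  have hA := measurableSet_near a x
  rw [measureReal_def, ← ENNReal.ofReal_le_iff_le_toReal (measure_ne_top _ _),
    ENNReal.ofReal_mul hl, marginalLaw, withDensity_apply _ hA]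
  have himg : Subtype.val '' {y : 𝒳 | ‖(x : E d) - (y : E d)‖ ≤ a} =
      𝒳 ∩ Metric.closedBall (x : E d) a := by
    ext y
    simp [dist_eq_norm, norm_sub_rev y, and_comm]
  calc ENNReal.ofReal l * ENNReal.ofReal (c₀ * a ^ d)
      ≤ ENNReal.ofReal l * volume (𝒳 ∩ Metric.closedBall (x : E d) a) := by
        gcongr; exact hx a ha0 ha1
    _ = ∫⁻ _ in {y : 𝒳 | ‖(x : E d) - (y : E d)‖ ≤ a}, ENNReal.ofReal l
          ∂((volume : Measure (E d)).comap Subtype.val) := by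
        rw [setLIntegral_const, (MeasurableEmbedding.subtype_coe h𝒳).comap_apply, himg]
    _ ≤ _ := lintegral_mono fun y => ENNReal.ofReal_le_ofReal (hm.lower y)

lemma KernelBounds.integrable (hK : KernelBounds K M κ R r) : Integrable K := by
  by_contra hcon
  have := hK.integral_eq_one
  rw [integral_undef hcon] at this
  exact zero_ne_one this

lemma KernelBounds.lintegral_scaledKernel_sub (hK : KernelBounds K M κ R r) (hh : 0 < h)
    (x : E d) : ∫⁻ y, ENNReal.ofReal (scaledKernel K h (x - y)) = 1 := by
  have h1 : Integrable fun y => scaledKernel K h (x - y) :=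
    Integrable.comp_sub_left (((integrable_comp_smul_iff volume K (inv_ne_zero hh.ne')).2
      hK.integrable).const_mul _) x
  rw [← ofReal_integral_eq_lintegral_ofReal h1
    (.of_forall fun y => hK.scaledKernel_nonneg hh _),
    integral_sub_left_eq_self (fun z => scaledKernel K h z)]
  unfold scaledKernel
  rw [integral_const_mul, Measure.integral_comp_smul, hK.integral_eq_one]
  have : 0 < h ^ d := by positivity
  simp [abs_of_pos this, this.ne']

/-- The mean of $K_h$ stays bounded although its supremum may be of order $h^{-d}$; the variance
bound for the U-statistic rests on this gap. -/
lemma IsDesignDensity.integral_scaledKernel_le (h𝒳 : MeasurableSet 𝒳)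
    (hm : IsDesignDensity l u m) (hK : KernelBounds K M κ R r) (hh : 0 < h) (hu : 0 ≤ u)
    (x : 𝒳) : ∫ y : 𝒳, scaledKernel K h ((x : E d) - (y : E d)) ∂(marginalLaw m) ≤ u := by
  have hmeas := hK.measurable_scaledKernel_sub (𝒳 := 𝒳) (h := h) (x : E d)
  rw [integral_eq_lintegral_of_nonneg_ae (.of_forall fun y => hK.scaledKernel_nonneg hh _)
    hmeas.aestronglyMeasurable]
  refine ENNReal.toReal_le_of_le_ofReal hu ?_
  have hle : marginalLaw m ≤
      ENNReal.ofReal u • (volume : Measure (E d)).comap (Subtype.val : 𝒳 → E d) := by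
    rw [← withDensity_const]
    exact withDensity_mono (.of_forall fun y => ENNReal.ofReal_le_ofReal (hm.upper y))
  calc ∫⁻ y : 𝒳, ENNReal.ofReal (scaledKernel K h ((x : E d) - (y : E d))) ∂(marginalLaw m)
      ≤ ENNReal.ofReal u * ∫⁻ y : 𝒳, ENNReal.ofReal (scaledKernel K h ((x : E d) - (y : E d)))
          ∂((volume : Measure (E d)).comap Subtype.val) := by
        rw [← smul_eq_mul, ← lintegral_smul_measure]
        exact lintegral_mono' hle le_rfl
    _ ≤ ENNReal.ofReal u * 1 := by
        gcongr
        rw [← hK.lintegral_scaledKernel_sub hh (x : E d),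
          lintegral_subtype_comap h𝒳 fun y => ENNReal.ofReal (scaledKernel K h ((x : E d) - y))]
        exact setLIntegral_le_lintegral _ _
    _ = _ := mul_one _

/-- The term of order $\lceil a\rceil$ of the exponential series already dominates, and $s\ge1$
allows returning to the real exponent $a$. -/
lemma exp_neg_mul_le {δ s a : ℝ} (hδ : 0 < δ) (hs : 1 ≤ s) :
    Real.exp (-(δ * s)) ≤ (⌈a⌉₊.factorial : ℝ) / δ ^ ⌈a⌉₊ * (s ^ a)⁻¹ := by
  have hs0 : 0 < s := by linarith
  have h1 := Real.pow_div_factorial_le_exp (δ * s) (by positivity) ⌈a⌉₊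
  have h2 : s ^ a ≤ s ^ ⌈a⌉₊ := by
    rw [← Real.rpow_natCast]
    exact Real.rpow_le_rpow_of_exponent_le hs (Nat.le_ceil a)
  have h3 : 0 < s ^ a := by positivity
  calc Real.exp (-(δ * s)) ≤ ((δ * s) ^ ⌈a⌉₊ / (⌈a⌉₊.factorial : ℝ))⁻¹ := by
        rw [Real.exp_neg]
        exact inv_anti₀ (by positivity) h1
    _ = (⌈a⌉₊.factorial : ℝ) / δ ^ ⌈a⌉₊ * (s ^ ⌈a⌉₊)⁻¹ := by
        rw [mul_pow]; field_simp
    _ ≤ _ := by gcongr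

/-- In the random design it is unlikely that the denominator of the smoother is small. -/
lemma IsDesignDensity.exists_measureReal_lowWeightSet_le (h𝒳 : MeasurableSet 𝒳)
    (hK : KernelBounds K M κ R r) (hν : 0 < ν) (hl : 0 < l) (hc₀ : 0 < c₀) :
    ∃ v > 0, ∃ D ≥ 0, ∀ (n : ℕ) (h lam : ℝ), Tuning d n h lam ν → ∀ m : 𝒳 → ℝ,
      IsDesignDensity l u m → ∀ x x' : 𝒳, VolumeRegularAt 𝒳 c₀ (x : E d) →
      VolumeRegularAt 𝒳 c₀ (x' : E d) →
      (randomDesignLaw n m).real (lowWeightSet n K h lam v x x') ≤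
        D * (((n : ℝ) * h ^ d) ^ (2 * ν + 2))⁻¹ := by
  classical
  have hr := hK.r_pos
  have hκ := hK.κ_pos
  -- The ball of radius $rh$ has probability $p\ge lc_0(rh)^d$, so $\delta nh^d\le np/4$, the
  -- Chernoff threshold.
  set δ : ℝ := l * (c₀ * r ^ d) / 4
  have hδ : 0 < δ := by positivity
  set k := ⌈2 * ν + 2⌉₊
  -- In $D$ the first term covers $nh^d<2/\delta$ trivially; the second is the tail bound, once for
  -- each query.
  refine ⟨κ ^ 2 * δ ^ 2 / 2, by positivity,
    (2 / δ) ^ (2 * ν + 2) + 2 * ((k.factorial : ℝ) / δ ^ k), by positivity,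
    fun n h lam H m hm x x' hx hx' => ?_⟩
  have := hm.isProbabilityMeasure
  have : IsProbabilityMeasure (randomDesignLaw n m) := by
    rw [randomDesignLaw]; infer_instance
  have hn := H.n_pos
  have hs := H.nh_pos
  have hh := H.h_pos
  rcases lt_or_ge ((n : ℝ) * h ^ d) (2 / δ) with hA | hA
  · have h1 : 1 ≤ (2 / δ) ^ (2 * ν + 2) * (((n : ℝ) * h ^ d) ^ (2 * ν + 2))⁻¹ := by
      rw [← div_eq_mul_inv, one_le_div (by positivity)]
      exact Real.rpow_le_rpow hs.le hA.le (by positivity)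
    have h2 : 0 ≤ 2 * ((k.factorial : ℝ) / δ ^ k) * (((n : ℝ) * h ^ d) ^ (2 * ν + 2))⁻¹ := by
      positivity
    rw [add_mul]
    exact measureReal_le_one.trans (by linarith)
  · have h2 : 2 ≤ δ * ((n : ℝ) * h ^ d) := by rwa [← div_le_iff₀' hδ]
    have htail : ∀ y : 𝒳, VolumeRegularAt 𝒳 c₀ (y : E d) →
        (randomDesignLaw n m).real
          {X | ((nearIndices (r * h) y X).card : ℝ) < δ * ((n : ℝ) * h ^ d)} ≤
          (k.factorial : ℝ) / δ ^ k * (((n : ℝ) * h ^ d) ^ (2 * ν + 2))⁻¹ := by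
      intro y hy
      have hp := hm.le_measureReal_near h𝒳 hl.le hy (a := r * h) (by positivity)
        (mul_le_one₀ hK.r_le_one hh.le H.h_le_one)
      have hδp : δ * ((n : ℝ) * h ^ d) ≤
          n * (marginalLaw m).real {z : 𝒳 | ‖(y : E d) - (z : E d)‖ ≤ r * h} / 4 := by
        calc δ * ((n : ℝ) * h ^ d) = n * (l * (c₀ * (r * h) ^ d)) / 4 := by
              simp only [δ, mul_pow]; ring
          _ ≤ _ := by gcongr
      refine le_trans ?_ (exp_neg_mul_le hδ H.one_le_nh)
      refine le_trans ?_ ((measureReal_card_lt_le (marginalLaw m)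
        (measurableSet_near (r * h) y) n).trans (Real.exp_le_exp.2 (neg_le_neg hδp)))
      refine measureReal_mono fun X hX => ?_
      have hX' : ((nearIndices (r * h) y X).card : ℝ) < δ * ((n : ℝ) * h ^ d) := hX
      refine lt_of_le_of_lt (le_of_eq ?_) (hX'.trans_le hδp)
      simp only [nearIndices, Set.mem_ofPred_eq]
    have hsub : lowWeightSet n K h lam (κ ^ 2 * δ ^ 2 / 2) x x' ⊆
        {X | ((nearIndices (r * h) x X).card : ℝ) < δ * ((n : ℝ) * h ^ d)} ∪
        {X | ((nearIndices (r * h) x' X).card : ℝ) < δ * ((n : ℝ) * h ^ d)} := by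
      intro X hX
      by_contra hcon
      simp only [Set.mem_union, Set.mem_ofPred_eq, not_or, not_lt] at hcon
      exact absurd (le_meanWeight hK H h2 hcon.1 hcon.2) (not_le.2 hX)
    have h3 := (measureReal_mono (μ := randomDesignLaw n m) hsub).trans
      (measureReal_union_le _ _)
    have h4 := htail x hx
    have h5 := htail x' hx'
    have h6 : 0 ≤ (2 / δ) ^ (2 * ν + 2) * (((n : ℝ) * h ^ d) ^ (2 * ν + 2))⁻¹ := by positivity
    rw [add_mul]
    linarith

end RandomDesign

/-! ### Variance of U-statistics of order two. -/

section UStatistic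

variable {α : Type*} [MeasurableSpace α] {P : Measure α} [IsProbabilityMeasure P] {n : ℕ}
  {ψ : α → ℝ} {φ : α × α → ℝ} {b c m : ℝ}

lemma integral_prod_coord_le (hψ0 : ∀ y, 0 ≤ ψ y) (hc : ∫ y, ψ y ∂P ≤ c) (s : Finset (Fin n)) :
    ∫ X, ∏ i ∈ s, ψ (X i) ∂(Measure.pi fun _ : Fin n => P) ≤ c ^ s.card := by
  have h1 : ∀ X : Fin n → α, ∏ i ∈ s, ψ (X i) = ∏ i, (if i ∈ s then ψ else fun _ => 1) (X i) := by
    intro X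
    rw [← Finset.prod_subset (Finset.subset_univ s)
      (f := fun i => (if i ∈ s then ψ else fun _ => 1) (X i))]
    · exact Finset.prod_congr rfl fun i hi => by simp [hi]
    · intro i _ hi
      simp [hi]
  simp only [h1]
  rw [integral_fintype_prod_eq_prod (fun i : Fin n => if i ∈ s then ψ else fun _ => 1),
    ← Finset.prod_subset (Finset.subset_univ s), ← Finset.prod_const]
  · exact Finset.prod_le_prod
      (fun i hi => by simpa [hi] using integral_nonneg hψ0) (fun i hi => by simpa [hi] using hc)
  · intro i _ hi
    simp [hi]

lemma integrable_prod_coord (hψ : Measurable ψ) (hψ0 : ∀ y, 0 ≤ ψ y) (hm : ∀ y, ψ y ≤ m)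
    (s : Finset (Fin n)) :
    Integrable (fun X => ∏ i ∈ s, ψ (X i)) (Measure.pi fun _ : Fin n => P) := by
  refine .of_bound (Finset.measurable_prod _ fun i _ =>
    hψ.comp (measurable_pi_apply i)).aestronglyMeasurable (m ^ s.card) (.of_forall fun X => ?_)
  rw [Real.norm_of_nonneg (Finset.prod_nonneg fun i _ => hψ0 _), ← Finset.prod_const]
  exact Finset.prod_le_prod (fun i _ => hψ0 _) (fun i _ => hm _)

lemma integral_mul_coord_le (hψ0 : ∀ y, 0 ≤ ψ y) (hc : ∫ y, ψ y ∂P ≤ c) {i j : Fin n}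
    (hij : i ≠ j) : ∫ X, ψ (X i) * ψ (X j) ∂(Measure.pi fun _ : Fin n => P) ≤ c ^ 2 := by
  classical
  have h1 := integral_prod_coord_le (n := n) hψ0 hc {i, j}
  simpa only [Finset.prod_pair hij, Finset.card_pair hij] using h1

/-- Each repeated coordinate has one of its two factors bounded by $m$; what remains is a product
over distinct, independent coordinates, each of mean at most $c$. As $c\ge1$, the power $c^4$ serves
both cases. -/
lemma integral_four_coord_le (hψ : Measurable ψ) (hψ0 : ∀ y, 0 ≤ ψ y) (hm : ∀ y, ψ y ≤ m)
    (hc1 : 1 ≤ c) (hc : ∫ y, ψ y ∂P ≤ c) {i j k : Fin n} (hij : i ≠ j)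
    (hik : i ≠ k) :
    ∫ X, ψ (X i) * ψ (X i) * (ψ (X j) * ψ (X k)) ∂(Measure.pi fun _ : Fin n => P) ≤
      c ^ 4 * if j = k then m ^ 2 else m := by
  classical
  split_ifs with hjk
  · subst hjk
    have h1 := integrable_prod_coord (P := P) (n := n) hψ hψ0 hm {i, j}
    have h2 := integral_prod_coord_le (n := n) hψ0 hc {i, j}
    simp only [Finset.prod_pair hij, Finset.card_pair hij] at h1 h2
    calc _ ≤ ∫ X, m ^ 2 * (ψ (X i) * ψ (X j)) ∂(Measure.pi fun _ : Fin n => P) := by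
          refine integral_mono_of_nonneg (.of_forall fun X => ?_) (h1.const_mul _)
            (.of_forall fun X => ?_)
          · exact mul_nonneg (mul_self_nonneg _) (mul_self_nonneg _)
          · have e1 := mul_le_mul (hm (X i)) (hm (X j)) (hψ0 _) ((hψ0 (X i)).trans (hm _))
            have e2 := mul_nonneg (hψ0 (X i)) (hψ0 (X j))
            dsimp only
            nlinarith [mul_le_mul_of_nonneg_right e1 e2]
      _ ≤ m ^ 2 * c ^ 4 := by
          rw [integral_const_mul]
          exact mul_le_mul_of_nonneg_left (h2.trans (pow_le_pow_right₀ hc1 (by norm_num)))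
            (sq_nonneg m)
      _ = _ := mul_comm _ _
  · have hcard : ({i, j, k} : Finset (Fin n)).card = 3 := Finset.card_eq_three.2
      ⟨i, j, k, hij, hik, hjk, rfl⟩
    have h1 := integrable_prod_coord (P := P) (n := n) hψ hψ0 hm {i, j, k}
    have h2 := integral_prod_coord_le (n := n) hψ0 hc {i, j, k}
    have hi : i ∉ ({j, k} : Finset (Fin n)) := by simp [hij, hik]
    simp only [Finset.prod_insert hi, Finset.prod_pair hjk, hcard] at h1 h2
    have hm0 : 0 ≤ m := by
      have := nonempty_of_isProbabilityMeasure P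
      exact (hψ0 this.some).trans (hm _)
    calc _ ≤ ∫ X, m * (ψ (X i) * (ψ (X j) * ψ (X k))) ∂(Measure.pi fun _ : Fin n => P) := by
          refine integral_mono_of_nonneg (.of_forall fun X => ?_) (h1.const_mul _)
            (.of_forall fun X => ?_)
          · exact mul_nonneg (mul_self_nonneg _) (mul_nonneg (hψ0 _) (hψ0 _))
          · dsimp only
            rw [mul_assoc]
            exact mul_le_mul_of_nonneg_right (hm _)
              (mul_nonneg (hψ0 _) (mul_nonneg (hψ0 _) (hψ0 _)))
      _ ≤ m * c ^ 4 := by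
          rw [integral_const_mul]
          exact mul_le_mul_of_nonneg_left (h2.trans (pow_le_pow_right₀ hc1 (by norm_num))) hm0
      _ = _ := mul_comm _ _

/-- Weights bounding the covariance of two summands of a U-statistic: `m` for each common
index, and `m ^ 2` more if the two index pairs agree up to order. -/
def overlap (m : ℝ) (p q : Fin n × Fin n) : ℝ :=
  m * ((if q.1 = p.1 then 1 else 0) + (if q.1 = p.2 then 1 else 0) +
    (if q.2 = p.1 then 1 else 0) + (if q.2 = p.2 then 1 else 0)) +
  m ^ 2 * ((if q = p then 1 else 0) + (if q = p.swap then 1 else 0))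

lemma overlap_nonneg (hm : 0 ≤ m) (p q : Fin n × Fin n) : 0 ≤ overlap m p q := by
  unfold overlap
  have h : ∀ (a : Prop) [Decidable a], (0 : ℝ) ≤ if a then 1 else 0 := fun a _ => by
    split_ifs <;> norm_num
  refine add_nonneg (mul_nonneg hm ?_) (mul_nonneg (sq_nonneg m) ?_) <;>
    repeat' first | apply add_nonneg | apply h

lemma sum_overlap (p : Fin n × Fin n) : ∑ q, overlap m p q = 4 * n * m + 2 * m ^ 2 := by
  unfold overlap
  have h1 : ∀ a : Fin n, ∑ q : Fin n × Fin n, (if q.1 = a then (1 : ℝ) else 0) = n := fun a => by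
    rw [Fintype.sum_prod_type_right]; simp
  have h2 : ∀ a : Fin n, ∑ q : Fin n × Fin n, (if q.2 = a then (1 : ℝ) else 0) = n := fun a => by
    rw [Fintype.sum_prod_type]; simp
  simp only [Finset.sum_add_distrib, ← Finset.mul_sum, h1, h2, Finset.sum_ite_eq',
    Finset.mem_univ, if_true]
  ring

/-- The bound $1\le$ `overlap` later absorbs the product of the means in the covariance. -/
lemma integral_mul_mul_le_overlap (hψ : Measurable ψ) (hψ0 : ∀ y, 0 ≤ ψ y)
    (hm1 : 1 ≤ m) (hm : ∀ y, ψ y ≤ m) (hc1 : 1 ≤ c) (hc : ∫ y, ψ y ∂P ≤ c)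
    {p q : Fin n × Fin n} (hp : p.1 ≠ p.2) (hq : q.1 ≠ q.2)
    (hpq : q.1 = p.1 ∨ q.1 = p.2 ∨ q.2 = p.1 ∨ q.2 = p.2) :
    1 ≤ overlap m p q ∧
    ∫ X, ψ (X p.1) * ψ (X p.2) * (ψ (X q.1) * ψ (X q.2)) ∂(Measure.pi fun _ : Fin n => P) ≤
      c ^ 4 * overlap m p q := by
  have hm0 : 0 ≤ m := zero_le_one.trans hm1
  have hmm : m ≤ m ^ 2 := by nlinarith
  -- Here $i$ is a shared index, and $j$, $k$ are its partners in the two pairs. If $j=k$ the pairs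
  -- agree up to order.
  have key : ∀ i j k : Fin n, i ≠ j → i ≠ k →
      (if j = k then m ^ 2 else m) ≤ overlap m p q →
      (∀ X : Fin n → α, ψ (X p.1) * ψ (X p.2) * (ψ (X q.1) * ψ (X q.2)) =
        ψ (X i) * ψ (X i) * (ψ (X j) * ψ (X k))) → _ := fun i j k hij hik ho hX =>
    (⟨le_trans (by split_ifs <;> nlinarith) ho, by
      simp only [hX]
      exact (integral_four_coord_le hψ hψ0 hm hc1 hc hij hik).trans
        (mul_le_mul_of_nonneg_left ho (by positivity))⟩ :
      1 ≤ overlap m p q ∧ ∫ X, ψ (X p.1) * ψ (X p.2) * (ψ (X q.1) * ψ (X q.2))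
        ∂(Measure.pi fun _ : Fin n => P) ≤ c ^ 4 * overlap m p q)
  obtain ⟨i, j⟩ := p
  obtain ⟨k, l⟩ := q
  simp only at hp hq hpq
  rcases hpq with rfl | rfl | rfl | rfl
  · refine key k j l hp hq ?_ (fun X => by ring)
    by_cases e : j = l
    · subst e; simp [overlap, hp, hp.symm]; nlinarith
    · simp [overlap, hp, hq.symm, e, Ne.symm e]
  · refine key k i l hp.symm hq ?_ (fun X => by ring)
    by_cases e : i = l
    · subst e; simp [overlap, hq, hq.symm]; nlinarith
    · simp [overlap, hp.symm, hq.symm, e, Ne.symm e]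
  · refine key l j k hp hq.symm ?_ (fun X => by ring)
    by_cases e : j = k
    · subst e; simp [overlap, hq, hq.symm]; nlinarith
    · simp [overlap, hp, hq, e, Ne.symm e]
  · refine key l i k hp.symm hq.symm ?_ (fun X => by ring)
    by_cases e : i = k
    · subst e; simp [overlap, hq, hq.symm]; nlinarith
    · simp [overlap, hp.symm, hq, e, Ne.symm e]

/-- Disjoint pairs are independent. Otherwise the mixed moment and the product of means are each at
most $b^2c^4$ times the overlap, hence the factor $2$. -/
lemma covariance_pair_le (hψ : Measurable ψ) (hφ : Measurable φ) (hψ0 : ∀ y, 0 ≤ ψ y)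
    (hm1 : 1 ≤ m) (hm : ∀ y, ψ y ≤ m) (hc1 : 1 ≤ c) (hc : ∫ y, ψ y ∂P ≤ c) (hb : 0 ≤ b)
    (hφψ : ∀ y z, |φ (y, z)| ≤ b * (ψ y * ψ z))
    {p q : Fin n × Fin n} (hp : p.1 ≠ p.2) (hq : q.1 ≠ q.2) :
    cov[fun X => φ (X p.1, X p.2), fun X => φ (X q.1, X q.2); Measure.pi fun _ : Fin n => P] ≤
      2 * b ^ 2 * c ^ 4 * overlap m p q := by
  have hm0 : 0 ≤ m := zero_le_one.trans hm1
  have hmeas : ∀ p : Fin n × Fin n, Measurable fun X : Fin n → α => φ (X p.1, X p.2) := fun p => by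
    have h1 : Measurable fun X : Fin n → α => (X p.1, X p.2) := by fun_prop
    exact hφ.comp h1
  have hLp : ∀ p : Fin n × Fin n,
      MemLp (fun X : Fin n → α => φ (X p.1, X p.2)) 2 (Measure.pi fun _ => P) := fun p =>
    .of_bound (hmeas p).aestronglyMeasurable (b * (m * m)) (.of_forall fun X =>
      (hφψ _ _).trans (mul_le_mul_of_nonneg_left (mul_le_mul (hm _) (hm _) (hψ0 _) hm0) hb))
  by_cases hpq : q.1 = p.1 ∨ q.1 = p.2 ∨ q.2 = p.1 ∨ q.2 = p.2
  · obtain ⟨h1, h2⟩ := integral_mul_mul_le_overlap hψ hψ0 hm1 hm hc1 hc hp hq hpq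
    rw [covariance_eq_sub (hLp p) (hLp q)]
    have hmean : ∀ p : Fin n × Fin n, p.1 ≠ p.2 →
        |∫ X, φ (X p.1, X p.2) ∂(Measure.pi fun _ : Fin n => P)| ≤ b * c ^ 2 := by
      intro p hp
      have hi := integrable_prod_coord (P := P) (n := n) hψ hψ0 hm {p.1, p.2}
      simp only [Finset.prod_pair hp] at hi
      refine abs_integral_le_integral_abs.trans ?_
      refine (integral_mono_of_nonneg (.of_forall fun X => abs_nonneg _) (hi.const_mul b)
        (.of_forall fun X => hφψ _ _)).trans ?_
      rw [integral_const_mul]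
      exact mul_le_mul_of_nonneg_left (integral_mul_coord_le hψ0 hc hp) hb
    have hprod : ∫ X, ((fun X : Fin n → α => φ (X p.1, X p.2)) *
        fun X : Fin n → α => φ (X q.1, X q.2)) X ∂(Measure.pi fun _ : Fin n => P) ≤
        b ^ 2 * (c ^ 4 * overlap m p q) := by
      refine (le_abs_self _).trans (abs_integral_le_integral_abs.trans ?_)
      refine le_trans ?_ (mul_le_mul_of_nonneg_left h2 (sq_nonneg b))
      rw [← integral_const_mul]
      have hψX : ∀ i : Fin n, Measurable fun X : Fin n → α => ψ (X i) := fun i =>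
        hψ.comp (measurable_pi_apply i)
      refine integral_mono_of_nonneg (.of_forall fun X => abs_nonneg _) ?_
        (.of_forall fun X => ?_)
      · refine .of_bound (C := b ^ 2 * (m * m * (m * m))) (Measurable.aestronglyMeasurable
          ((((hψX _).mul (hψX _)).mul ((hψX _).mul (hψX _))).const_mul _))
          (.of_forall fun X => ?_)
        have e : ∀ i j, 0 ≤ ψ (X i) * ψ (X j) := fun i j => mul_nonneg (hψ0 _) (hψ0 _)
        have e' : ∀ i j, ψ (X i) * ψ (X j) ≤ m * m := fun i j =>
          mul_le_mul (hm _) (hm _) (hψ0 _) hm0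
        rw [Real.norm_of_nonneg (mul_nonneg (sq_nonneg b) (mul_nonneg (e _ _) (e _ _)))]
        exact mul_le_mul_of_nonneg_left (mul_le_mul (e' _ _) (e' _ _) (e _ _)
          (mul_nonneg hm0 hm0)) (sq_nonneg b)
      · dsimp only [Pi.mul_apply]
        rw [abs_mul]
        refine (mul_le_mul (hφψ _ _) (hφψ _ _) (abs_nonneg _)
          (mul_nonneg hb (mul_nonneg (hψ0 _) (hψ0 _)))).trans_eq ?_
        ring
    have h3 := mul_le_mul (hmean p hp) (hmean q hq) (abs_nonneg _) (by positivity)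
    rw [← abs_mul] at h3
    have h4 := neg_abs_le ((∫ X, φ (X p.1, X p.2) ∂(Measure.pi fun _ : Fin n => P)) *
      ∫ X, φ (X q.1, X q.2) ∂(Measure.pi fun _ : Fin n => P))
    have h5 : b ^ 2 * c ^ 4 * 1 ≤ b ^ 2 * c ^ 4 * overlap m p q :=
      mul_le_mul_of_nonneg_left h1 (by positivity)
    nlinarith
  · push Not at hpq
    have hind : iIndepFun (fun (i : Fin n) (X : Fin n → α) => X i) (Measure.pi fun _ => P) :=
      iIndepFun_pi (X := fun _ y => y) fun _ => aemeasurable_id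
    have h1 := (hind.indepFun_prodMk_prodMk (fun i => measurable_pi_apply i) p.1 p.2 q.1 q.2
      hpq.1.symm hpq.2.2.1.symm hpq.2.1.symm hpq.2.2.2.symm).comp hφ hφ
    have h2 : cov[fun X => φ (X p.1, X p.2), fun X => φ (X q.1, X q.2);
        Measure.pi fun _ : Fin n => P] = 0 := h1.covariance_eq_zero (hLp p) (hLp q)
    rw [h2]
    exact mul_nonneg (by positivity) (overlap_nonneg hm0 p q)

/-- Variance bound for a U-statistic of order two whose kernel is dominated by a product. -/
lemma variance_sum_pair_le (hψ : Measurable ψ) (hφ : Measurable φ) (hψ0 : ∀ y, 0 ≤ ψ y)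
    (hm1 : 1 ≤ m) (hm : ∀ y, ψ y ≤ m) (hc1 : 1 ≤ c) (hc : ∫ y, ψ y ∂P ≤ c) (hb : 0 ≤ b)
    (hφψ : ∀ y z, |φ (y, z)| ≤ b * (ψ y * ψ z)) :
    Var[fun X => ∑ p ∈ indexSet n, φ (X p.1, X p.2); Measure.pi fun _ : Fin n => P] ≤
      8 * b ^ 2 * c ^ 4 * ((n : ℝ) ^ 3 * m + (n : ℝ) ^ 2 * m ^ 2) := by
  have hm0 : 0 ≤ m := zero_le_one.trans hm1
  rw [variance_fun_sum']
  · calc _ ≤ ∑ p ∈ indexSet n, ∑ q ∈ indexSet n, 2 * b ^ 2 * c ^ 4 * overlap m p q :=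
          Finset.sum_le_sum fun p hp => Finset.sum_le_sum fun q hq =>
            covariance_pair_le hψ hφ hψ0 hm1 hm hc1 hc hb hφψ (by simpa using hp)
              (by simpa using hq)
      _ ≤ ∑ p ∈ indexSet n, 2 * b ^ 2 * c ^ 4 * (4 * n * m + 2 * m ^ 2) := by
          refine Finset.sum_le_sum fun p _ => ?_
          rw [← sum_overlap p, Finset.mul_sum]
          exact Finset.sum_le_sum_of_subset_of_nonneg (Finset.subset_univ _) fun q _ _ =>
            mul_nonneg (by positivity) (overlap_nonneg hm0 p q)
      _ = (indexSet n).card * (2 * b ^ 2 * c ^ 4 * (4 * n * m + 2 * m ^ 2)) := by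
          rw [Finset.sum_const, nsmul_eq_mul]
      _ ≤ (n : ℝ) ^ 2 * (2 * b ^ 2 * c ^ 4 * (4 * n * m + 2 * m ^ 2)) := by
          gcongr; exact indexSet_card_le n
      _ ≤ _ := by
          have : 0 ≤ b ^ 2 * c ^ 4 * ((n : ℝ) ^ 2 * m ^ 2) := by positivity
          nlinarith
  · intro p _
    have h1 : Measurable fun X : Fin n → α => (X p.1, X p.2) := by fun_prop
    exact .of_bound (hφ.comp h1).aestronglyMeasurable (b * (m * m)) (.of_forall fun X =>
      (hφψ _ _).trans (mul_le_mul_of_nonneg_left (mul_le_mul (hm _) (hm _) (hψ0 _) hm0) hb))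

end UStatistic

/-! ### Variance of the conditional bias in the random design. -/

section ConditionalBias

variable {d n : ℕ} {𝒳 : Set (E d)} {K : E d → ℝ} {M κ R r β L h lam ν τ v D c₀ l u : ℝ}
  {m : 𝒳 → ℝ} {Q : Kernel (𝒳 × 𝒳) ℝ} {f : 𝒳 → 𝒳 → ℝ}

lemma meanWeight_le (hK : KernelBounds K M κ R r) (H : Tuning d n h lam ν) (x x' : 𝒳)
    (X : Fin n → 𝒳) : meanWeight K h lam x x' X ≤ 2 * M ^ 2 * ((h ^ d)⁻¹) ^ 2 := by
  rw [meanWeight, inv_mul_le_iff₀ H.card_pos, totalWeight, ← nsmul_eq_mul]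
  exact Finset.sum_le_card_nsmul _ _ _ fun p _ => weight_le hK H x x' X p

lemma KernelBounds.integrable_meanWeight (μ : Measure (Fin n → 𝒳)) [IsProbabilityMeasure μ]
    (hK : KernelBounds K M κ R r) (H : Tuning d n h lam ν) (x x' : 𝒳) :
    Integrable (meanWeight K h lam x x') μ :=
  .of_bound (hK.measurable_meanWeight x x').aestronglyMeasurable _ (.of_forall fun X => by
    rw [Real.norm_of_nonneg (meanWeight_pos hK H x x' X).le]
    exact meanWeight_le hK H x x' X)

/-- The ratio of the means of the numerator and the denominator of the conditional bias. -/
def biasRatio (μ : Measure (Fin n → 𝒳)) (K : E d → ℝ) (h lam : ℝ) (x x' : 𝒳)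
    (f : 𝒳 → 𝒳 → ℝ) : ℝ :=
  (∫ X, meanWeight K h lam x x' X * (condMean K h lam x x' f X - f x x') ∂μ) /
    ∫ X, meanWeight K h lam x x' X ∂μ

lemma integrable_meanWeight_mul (μ : Measure (Fin n → 𝒳)) [IsProbabilityMeasure μ]
    (hK : KernelBounds K M κ R r) (H : Tuning d n h lam ν) (hf : f ∈ holderClass 𝒳 β L)
    (hQ : HasMeanAndVarianceLT Q f τ) (x x' : 𝒳) :
    Integrable (fun X => meanWeight K h lam x x' X * (condMean K h lam x x' f X - f x x')) μ :=
  (hK.integrable_meanWeight μ H x x').mul_bdd (c := 2 * L)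
    ((measurable_condMean hK hQ x x').sub_const _).aestronglyMeasurable
    (.of_forall fun X => abs_condMean_sub_le_two_mul hK H hf x x' X)

lemma half_le_integral_meanWeight (μ : Measure (Fin n → 𝒳)) [IsProbabilityMeasure μ]
    (hK : KernelBounds K M κ R r) (H : Tuning d n h lam ν) (x x' : 𝒳) (hv : 0 < v)
    (hμ : μ.real (lowWeightSet n K h lam v x x') ≤ 1 / 2) :
    v / 2 ≤ ∫ X, meanWeight K h lam x x' X ∂μ := by
  have h1 := mul_meas_ge_le_integral_of_nonneg
    (.of_forall fun X => (meanWeight_pos hK H x x' X).le) (hK.integrable_meanWeight μ H x x') v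
  have h2 := probReal_compl_eq_one_sub (μ := μ)
    (hK.measurableSet_lowWeightSet (n := n) (h := h) (lam := lam) (v := v) x x')
  have h3 : (lowWeightSet n K h lam v x x')ᶜ = {X | v ≤ meanWeight K h lam x x' X} := by
    ext X; simp [lowWeightSet]
  rw [h3] at h2
  nlinarith

/-- The ratio is the mean of $T-f(x,x')$ under the law of $X$ reweighted by $V$, so it inherits the
uniform bound $2L$. -/
lemma abs_biasRatio_le (μ : Measure (Fin n → 𝒳)) [IsProbabilityMeasure μ]
    (hK : KernelBounds K M κ R r) (H : Tuning d n h lam ν) (hL : 0 ≤ L) (hβ0 : 0 ≤ β)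
    (hβ1 : β ≤ 1) (hf : f ∈ holderClass 𝒳 β L) (x x' : 𝒳)
    (hv : 0 < v) (hμ : μ.real (lowWeightSet n K h lam v x x') ≤ 1 / 2) :
    |biasRatio μ K h lam x x' f| ≤ 2 * L ∧
      |biasRatio μ K h lam x x' f| ≤ (2 * L * R + 4 * L / v) * h ^ β := by
  have hV := half_le_integral_meanWeight μ hK H x x' hv hμ
  have hV0 : 0 < ∫ X, meanWeight K h lam x x' X ∂μ := by linarith
  have hi := hK.integrable_meanWeight μ H x x'
  have hβ := Real.rpow_nonneg H.h_pos.le β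
  have hpos := fun X => meanWeight_pos hK H x x' (X : Fin n → 𝒳)
  rw [biasRatio, abs_div, abs_of_pos hV0, div_le_iff₀ hV0, div_le_iff₀ hV0]
  constructor
  · refine abs_integral_le_integral_abs.trans ?_
    rw [← integral_const_mul]
    refine integral_mono_of_nonneg (.of_forall fun X => abs_nonneg _) (hi.const_mul _)
      (.of_forall fun X => ?_)
    dsimp only
    rw [abs_mul, abs_of_pos (hpos X), mul_comm]
    exact mul_le_mul_of_nonneg_right (abs_condMean_sub_le_two_mul hK H hf x x' X) (hpos X).le
  · have h1 : |∫ X, meanWeight K h lam x x' X * (condMean K h lam x x' f X - f x x') ∂μ| ≤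
        2 * L * R * h ^ β * (∫ X, meanWeight K h lam x x' X ∂μ) + 2 * L * h ^ β := by
      have h2 : ∫ X, (2 * L * R * h ^ β * meanWeight K h lam x x' X + 2 * L * h ^ β) ∂μ =
          2 * L * R * h ^ β * (∫ X, meanWeight K h lam x x' X ∂μ) + 2 * L * h ^ β := by
        rw [integral_add (hi.const_mul _) (integrable_const _), integral_const_mul]
        simp
      rw [← h2]
      refine abs_integral_le_integral_abs.trans (integral_mono_of_nonneg
        (.of_forall fun X => abs_nonneg _) ((hi.const_mul _).add (integrable_const _))
        (.of_forall fun X => ?_))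
      dsimp only
      rw [abs_mul, abs_of_pos (hpos X)]
      -- The bias bound is applied with $v=V(X)$ itself: the factor $V(X)$ cancels the division, so
      -- no exceptional set is needed. Then $E[V]\ge v/2$ turns $2L$ into $4L/v$.
      refine (mul_le_mul_of_nonneg_left (abs_condMean_sub_le hK H hL hβ0 hβ1 hf x x' X (hpos X)
        le_rfl) (hpos X).le).trans_eq ?_
      have := (hpos X).ne'
      field_simp
    refine h1.trans ?_
    have h3 : 2 * L * h ^ β ≤ 4 * L / v * h ^ β * ∫ X, meanWeight K h lam x x' X ∂μ := by
      calc 2 * L * h ^ β = 4 * L / v * h ^ β * (v / 2) := by field_simp; ring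
        _ ≤ _ := by gcongr
    linarith

/-- The summand whose average over index pairs is the centred numerator of the conditional
bias. -/
def centredSummand (K : E d → ℝ) (h lam : ℝ) (x x' : 𝒳) (f : 𝒳 → 𝒳 → ℝ) (ρ : ℝ)
    (p : 𝒳 × 𝒳) : ℝ :=
  (scaledKernel K h ((x : E d) - (p.1 : E d)) * scaledKernel K h ((x' : E d) - (p.2 : E d)) +
    lam) * (f p.1 p.2 - f x x' - ρ)

/-- Multiplying by the denominator turns a ratio of sums into a plain sum over index pairs. -/
lemma meanWeight_mul_condMean_sub (hK : KernelBounds K M κ R r) (H : Tuning d n h lam ν)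
    (x x' : 𝒳) (f : 𝒳 → 𝒳 → ℝ) (ρ : ℝ) (X : Fin n → 𝒳) :
    meanWeight K h lam x x' X * (condMean K h lam x x' f X - f x x' - ρ) =
      ((indexSet n).card : ℝ)⁻¹ *
        ∑ p ∈ indexSet n, centredSummand K h lam x x' f ρ (X p.1, X p.2) := by
  have hS := (totalWeight_pos hK H x x' X).ne'
  rw [condMean_sub hK H, meanWeight, mul_assoc, mul_sub, mul_div_cancel₀ _ hS]
  congr 1
  simp only [centredSummand, kernelWeight, totalWeight, mul_sub, Finset.sum_sub_distrib,
    Finset.sum_mul]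

/-- The function of one covariate whose products dominate the summands. -/
def dominatingWeight (K : E d → ℝ) (h : ℝ) (x x' : 𝒳) (y : 𝒳) : ℝ :=
  scaledKernel K h ((x : E d) - (y : E d)) + scaledKernel K h ((x' : E d) - (y : E d)) + 1

lemma abs_centredSummand_le (hK : KernelBounds K M κ R r) (H : Tuning d n h lam ν)
    (hL : 0 ≤ L) (hβ0 : 0 ≤ β) (hβ1 : β ≤ 1) (hf : f ∈ holderClass 𝒳 β L) (x x' : 𝒳)
    {ρ a : ℝ} (hρ : |ρ| ≤ a * h ^ β) (y z : 𝒳) :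
    |centredSummand K h lam x x' f ρ (y, z)| ≤ (2 * L * R + a) * h ^ β *
      (dominatingWeight K h x x' y * dominatingWeight K h x x' z) := by
  have hβ := Real.rpow_nonneg H.h_pos.le β
  have hR := zero_le_one.trans hK.one_le_R
  have hx := fun w : 𝒳 => hK.scaledKernel_nonneg H.h_pos ((x : E d) - (w : E d))
  have hx' := fun w : 𝒳 => hK.scaledKernel_nonneg H.h_pos ((x' : E d) - (w : E d))
  have h1 : |f y z - f x x'| * (scaledKernel K h ((x : E d) - (y : E d)) *
      scaledKernel K h ((x' : E d) - (z : E d))) ≤ 2 * L * R * h ^ β *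
      (scaledKernel K h ((x : E d) - (y : E d)) * scaledKernel K h ((x' : E d) - (z : E d))) := by
    by_cases h0 : scaledKernel K h ((x : E d) - (y : E d)) *
        scaledKernel K h ((x' : E d) - (z : E d)) = 0
    · simp [h0]
    · exact mul_le_mul_of_nonneg_right (abs_sub_le_of_kernelWeight_ne_zero hf hL hβ0 hβ1 hK H.h_pos
        -- The points $y,z$ are treated as a sample of size two.
        (X := ![y, z]) (p := (0, 1)) h0) (mul_nonneg (hx y) (hx' z))
  have h2 : |f y z - f x x'| * lam ≤ 2 * L * R * h ^ β := by
    have e1 := mul_le_mul (abs_sub_le_two_mul hf x x' y z) (H.lam_le_rpow hβ1) H.lam_pos.le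
      (by positivity)
    have e2 := mul_le_mul_of_nonneg_left hK.one_le_R (by positivity : 0 ≤ 2 * L * h ^ β)
    linarith
  have h3 : scaledKernel K h ((x : E d) - (y : E d)) * scaledKernel K h ((x' : E d) - (z : E d))
      + 1 ≤ dominatingWeight K h x x' y * dominatingWeight K h x x' z := by
    unfold dominatingWeight
    nlinarith [mul_nonneg (hx y) (hx z), mul_nonneg (hx' y) (hx z), mul_nonneg (hx' y) (hx' z),
      hx y, hx z, hx' y, hx' z]
  have h4 : 0 ≤ scaledKernel K h ((x : E d) - (y : E d)) *
      scaledKernel K h ((x' : E d) - (z : E d)) := mul_nonneg (hx y) (hx' z)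
  have ha : 0 ≤ a * h ^ β := (abs_nonneg ρ).trans hρ
  rw [centredSummand, abs_mul, abs_of_nonneg (add_nonneg h4 H.lam_pos.le)]
  refine le_trans (mul_le_mul_of_nonneg_left (abs_sub _ _) (add_nonneg h4 H.lam_pos.le)) ?_
  refine le_trans ?_ (mul_le_mul_of_nonneg_left h3 (by rw [add_mul]; positivity))
  have h5 := mul_le_mul_of_nonneg_left hρ (add_nonneg h4 zero_le_one)
  have h6 := mul_le_mul_of_nonneg_right (H.lam_le.trans H.hd_le_one) (abs_nonneg ρ)
  dsimp only
  nlinarith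

/-- Variance of the centred numerator of the conditional bias in the random design. -/
lemma variance_centred_le (h𝒳 : MeasurableSet 𝒳) (hK : KernelBounds K M κ R r)
    (H : Tuning d n h lam ν) (hL : 0 ≤ L) (hβ0 : 0 ≤ β) (hβ1 : β ≤ 1)
    (hf : f ∈ holderClass 𝒳 β L) (hQ : HasMeanAndVarianceLT Q f τ) (hu : 0 ≤ u)
    (hm : IsDesignDensity l u m) (x x' : 𝒳) {ρ a : ℝ} (ha : 0 ≤ a) (hρ : |ρ| ≤ a * h ^ β) :
    Var[fun X => meanWeight K h lam x x' X * (condMean K h lam x x' f X - f x x' - ρ);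
      randomDesignLaw n m] ≤
      384 * (2 * L * R + a) ^ 2 * (2 * u + 1) ^ 4 * M ^ 2 *
        (h ^ (2 * β) * ((n : ℝ) * h ^ d)⁻¹) := by
  have := hm.isProbabilityMeasure
  have hβ := Real.rpow_nonneg H.h_pos.le β
  have hR := zero_le_one.trans hK.one_le_R
  have hM := hK.one_le_M
  have hn := H.n_pos
  have hh := H.hd_pos
  have hs := H.nh_pos
  have hinv : 1 ≤ (h ^ d)⁻¹ := (one_le_inv₀ hh).2 H.hd_le_one
  have hx := fun w : 𝒳 => hK.scaledKernel_nonneg H.h_pos ((x : E d) - (w : E d))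
  have hx' := fun w : 𝒳 => hK.scaledKernel_nonneg H.h_pos ((x' : E d) - (w : E d))
  have hxm := hK.measurable_scaledKernel_sub (𝒳 := 𝒳) (h := h) (x : E d)
  have hxm' := hK.measurable_scaledKernel_sub (𝒳 := 𝒳) (h := h) (x' : E d)
  have hψ : Measurable (dominatingWeight K h x x') := (hxm.add hxm').add_const 1
  have hψ0 : ∀ y, 0 ≤ dominatingWeight K h x x' y := fun y => by
    have := hx y; have := hx' y; unfold dominatingWeight; positivity
  have hle := fun (w y : 𝒳) => hK.scaledKernel_le H.h_pos ((w : E d) - (y : E d))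
  have h1M : 1 ≤ (h ^ d)⁻¹ * M := one_le_mul_of_one_le_of_one_le hinv hM
  have hψm : ∀ y, dominatingWeight K h x x' y ≤ 3 * ((h ^ d)⁻¹ * M) := fun y => by
    have := hle x y; have := hle x' y; unfold dominatingWeight; linarith
  have hint : ∀ w : 𝒳, Integrable (fun y : 𝒳 => scaledKernel K h ((w : E d) - (y : E d)))
      (marginalLaw m) := fun w =>
    .of_bound (hK.measurable_scaledKernel_sub (w : E d)).aestronglyMeasurable _
      (.of_forall fun y => by
        rw [Real.norm_of_nonneg (hK.scaledKernel_nonneg H.h_pos _)]; exact hle w y)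
  have hψc : ∫ y, dominatingWeight K h x x' y ∂(marginalLaw m) ≤ 2 * u + 1 := by
    unfold dominatingWeight
    have e0 : Integrable (fun y : 𝒳 => scaledKernel K h ((x : E d) - (y : E d)) +
        scaledKernel K h ((x' : E d) - (y : E d))) (marginalLaw m) := (hint x).add (hint x')
    rw [integral_add e0 (integrable_const _), integral_add (hint x) (hint x')]
    have e1 := hm.integral_scaledKernel_le h𝒳 hK H.h_pos hu x
    have e2 := hm.integral_scaledKernel_le h𝒳 hK H.h_pos hu x'
    simp only [integral_const, probReal_univ, smul_eq_mul, mul_one]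
    linarith
  have hφ : Measurable (centredSummand K h lam x x' f ρ) :=
    (((hxm.comp measurable_fst).mul (hxm'.comp measurable_snd)).add_const lam).mul
      ((hQ.measurable.sub_const _).sub_const _)
  -- The single function $\psi$ covers both queries. It has mean at most $2u+1$ and supremum at most
  -- $3Mh^{-d}$.
  have hvar := variance_sum_pair_le (n := n) (P := marginalLaw m)
    (b := (2 * L * R + a) * h ^ β) (c := 2 * u + 1) (m := 3 * ((h ^ d)⁻¹ * M)) hψ hφ hψ0
    (by linarith) hψm (by linarith) hψc (by positivity)
    (abs_centredSummand_le hK H hL hβ0 hβ1 hf x x' hρ)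
  simp only [meanWeight_mul_condMean_sub hK H]
  rw [variance_const_mul, inv_pow, H.rpow_two_mul, inv_mul_le_iff₀ (pow_pos H.card_pos 2)]
  have hcard : ((n : ℝ) ^ 2 / 2) ^ 2 ≤ ((indexSet n).card : ℝ) ^ 2 :=
    pow_le_pow_left₀ (by positivity) H.le_card 2
  refine hvar.trans (le_trans ?_ (mul_le_mul_of_nonneg_right hcard (by positivity)))
  -- In terms of $t=(nh^d)^{-1}\le1$ one has $h^{-d}=nt$, and $3+9=12$. With the factor $8$ of the
  -- U-statistic bound and the $4$ lost in $|I_n|^2\ge n^4/4$ this yields $384$.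
  have hsum : (n : ℝ) ^ 3 * (3 * ((h ^ d)⁻¹ * M)) + (n : ℝ) ^ 2 * (3 * ((h ^ d)⁻¹ * M)) ^ 2 ≤
      (n : ℝ) ^ 4 * (12 * M ^ 2 * ((n : ℝ) * h ^ d)⁻¹) := by
    set t := ((n : ℝ) * h ^ d)⁻¹ with ht
    have ht0 : 0 < t := inv_pos.2 hs
    have ht1 : t ≤ 1 := inv_le_one_of_one_le₀ H.one_le_nh
    have e : (h ^ d)⁻¹ = n * t := by rw [ht]; field_simp
    rw [e]
    have e1 : t * M ≤ t * M ^ 2 := mul_le_mul_of_nonneg_left (by nlinarith) ht0.le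
    have e2 : t ^ 2 * M ^ 2 ≤ t * M ^ 2 := mul_le_mul_of_nonneg_right (by nlinarith) (sq_nonneg M)
    calc _ = (n : ℝ) ^ 4 * (3 * (t * M) + 9 * (t ^ 2 * M ^ 2)) := by ring
      _ ≤ (n : ℝ) ^ 4 * (12 * M ^ 2 * t) := by gcongr; linarith
  refine (mul_le_mul_of_nonneg_left hsum (by positivity)).trans_eq ?_
  ring

lemma variance_le_integral_sub_sq {α : Type*} [MeasurableSpace α] (μ : Measure α)
    [IsProbabilityMeasure μ] {g : α → ℝ} (hg : AEStronglyMeasurable g μ) (a : ℝ) :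
    Var[g; μ] ≤ ∫ x, (g x - a) ^ 2 ∂μ := by
  rw [← variance_sub_const hg a]
  exact variance_le_expectation_sq (hg.sub aestronglyMeasurable_const)

/-- The variance is bounded by the mean square about $f(x,x')+\rho$. Where $V\ge v$, passing to $Z$
costs $v^{-2}$; elsewhere $|T-f(x,x')-\rho|\le4L$. -/
lemma IsDesignDensity.variance_condMean_le (h𝒳 : MeasurableSet 𝒳) (hK : KernelBounds K M κ R r)
    (H : Tuning d n h lam ν) (hL : 0 ≤ L) (hβ0 : 0 ≤ β) (hβ1 : β ≤ 1)
    (hf : f ∈ holderClass 𝒳 β L) (hQ : HasMeanAndVarianceLT Q f τ) (hu : 0 ≤ u)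
    (hm : IsDesignDensity l u m) (x x' : 𝒳) (hv : 0 < v)
    (hμ : (randomDesignLaw n m).real (lowWeightSet n K h lam v x x') ≤
      D * (h ^ (2 * β) * ((n : ℝ) * h ^ d)⁻¹)) :
    Var[condMean K h lam x x' f; randomDesignLaw n m] ≤
      ((384 * (2 * L * R + (2 * L * R + 4 * L / v)) ^ 2 * (2 * u + 1) ^ 4 * M ^ 2) / v ^ 2 +
        16 * L ^ 2 * D) * (h ^ (2 * β) * ((n : ℝ) * h ^ d)⁻¹) := by
  have := hm.isProbabilityMeasure
  have : IsProbabilityMeasure (randomDesignLaw n m) := by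
    rw [randomDesignLaw]; infer_instance
  set μ := randomDesignLaw n m
  set ε := h ^ (2 * β) * ((n : ℝ) * h ^ d)⁻¹
  have hε : 0 ≤ ε := mul_nonneg (Real.rpow_nonneg H.h_pos.le _) (inv_nonneg.2 H.nh_pos.le)
  have hR := zero_le_one.trans hK.one_le_R
  have hTm := measurable_condMean (n := n) (h := h) (lam := lam) hK hQ x x'
  have hlow := hK.measurableSet_lowWeightSet (n := n) (h := h) (lam := lam) (v := v) x x'
  have hD := mul_le_mul_of_nonneg_left hμ (by positivity : 0 ≤ 16 * L ^ 2)
  -- The control of $\rho$ needs $E[V]\ge v/2$. If the low-weight event has probability above $1/2$,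
  -- the term $16L^2D$ alone exceeds the trivial variance bound $(2L)^2$.
  rcases le_or_gt (μ.real (lowWeightSet n K h lam v x x')) (1 / 2) with hhalf | hhalf
  · obtain ⟨hρ1, hρ2⟩ := abs_biasRatio_le μ hK H hL hβ0 hβ1 hf x x' hv hhalf
    have hVpos := half_le_integral_meanWeight μ hK H x x' hv hhalf
    set ρ := biasRatio μ K h lam x x' f with hρ_def
    have hvar := variance_centred_le h𝒳 hK H hL hβ0 hβ1 hf hQ hu hm x x'
      (by positivity) hρ2
    set Z : (Fin n → 𝒳) → ℝ := fun X =>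
      meanWeight K h lam x x' X * (condMean K h lam x x' f X - f x x' - ρ) with hZ_def
    have hZm : Measurable Z :=
      (hK.measurable_meanWeight x x').mul ((hTm.sub_const _).sub_const _)
    have hZb : ∀ X, ‖Z X‖ ≤ 2 * M ^ 2 * ((h ^ d)⁻¹) ^ 2 * (2 * L + 2 * L) := fun X => by
      have e1 := meanWeight_pos hK H x x' X
      rw [Real.norm_eq_abs, abs_mul, abs_of_pos e1]
      exact mul_le_mul (meanWeight_le hK H x x' X)
        ((abs_sub _ _).trans (add_le_add (abs_condMean_sub_le_two_mul hK H hf x x' X) hρ1))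
        (abs_nonneg _) (e1.le.trans (meanWeight_le hK H x x' X))
    have hZLp : MemLp Z 2 μ := .of_bound hZm.aestronglyMeasurable _ (.of_forall hZb)
    -- The ratio $\rho$ is chosen for this: the variance of $Z$ is then its second moment.
    have hZ0 : ∫ X, Z X ∂μ = 0 := by
      have e1 : ∀ X, Z X = meanWeight K h lam x x' X * (condMean K h lam x x' f X - f x x') -
          ρ * meanWeight K h lam x x' X := fun X => by simp only [hZ_def]; ring
      simp only [e1]
      rw [integral_sub (integrable_meanWeight_mul μ hK H hf hQ x x')
        ((hK.integrable_meanWeight μ H x x').const_mul _), integral_const_mul, hρ_def, biasRatio,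
        div_mul_cancel₀ _ (by linarith), sub_self]
    rw [variance_of_integral_eq_zero hZm.aemeasurable hZ0] at hvar
    have hi : Integrable ((lowWeightSet n K h lam v x x').indicator fun _ => 16 * L ^ 2) μ :=
      (integrable_const _).indicator hlow
    calc Var[condMean K h lam x x' f; μ]
        ≤ ∫ X, (condMean K h lam x x' f X - (f x x' + ρ)) ^ 2 ∂μ :=
          variance_le_integral_sub_sq μ hTm.aestronglyMeasurable _
      _ ≤ ∫ X, ((v ^ 2)⁻¹ * Z X ^ 2 +
          (lowWeightSet n K h lam v x x').indicator (fun _ => 16 * L ^ 2) X) ∂μ := by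
          refine integral_mono_of_nonneg (.of_forall fun X => sq_nonneg _)
            ((hZLp.integrable_sq.const_mul _).add hi) (.of_forall fun X => ?_)
          dsimp only
          rw [← sub_sub]
          by_cases hX : X ∈ lowWeightSet n K h lam v x x'
          · rw [Set.indicator_of_mem hX]
            have e1 : |condMean K h lam x x' f X - f x x' - ρ| ≤ 4 * L := by
              have := abs_sub (condMean K h lam x x' f X - f x x') ρ
              have := abs_condMean_sub_le_two_mul hK H hf x x' X
              linarith
            have e2 := sq_le_sq' (abs_le.1 e1).1 (abs_le.1 e1).2
            have e3 : 0 ≤ (v ^ 2)⁻¹ * Z X ^ 2 := by positivity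
            linarith
          · rw [Set.indicator_of_notMem hX, add_zero, le_inv_mul_iff₀ (by positivity), hZ_def]
            dsimp only
            rw [mul_pow]
            have : v ≤ meanWeight K h lam x x' X := not_lt.1 hX
            gcongr
      _ = (v ^ 2)⁻¹ * (∫ X, Z X ^ 2 ∂μ) +
          16 * L ^ 2 * μ.real (lowWeightSet n K h lam v x x') := by
          rw [integral_add (hZLp.integrable_sq.const_mul _) hi, integral_const_mul,
            integral_indicator_const _ hlow, smul_eq_mul, mul_comm (μ.real _)]
      _ ≤ _ := by
          have := mul_le_mul_of_nonneg_left hvar (by positivity : 0 ≤ (v ^ 2)⁻¹)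
          rw [div_eq_inv_mul]
          linarith
  · have h1 : Var[condMean K h lam x x' f; μ] ≤ (2 * L) ^ 2 := by
      refine (variance_le_integral_sub_sq μ hTm.aestronglyMeasurable (f x x')).trans ?_
      have h2 : ∫ _ : Fin n → 𝒳, (2 * L) ^ 2 ∂μ = (2 * L) ^ 2 := by simp
      rw [← h2]
      refine integral_mono_of_nonneg (.of_forall fun X => sq_nonneg _) (integrable_const _)
        (.of_forall fun X => ?_)
      have := abs_condMean_sub_le_two_mul hK H hf x x' X
      exact sq_le_sq' (abs_le.1 this).1 (abs_le.1 this).2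
    have h2 : 0 ≤ (384 * (2 * L * R + (2 * L * R + 4 * L / v)) ^ 2 * (2 * u + 1) ^ 4 * M ^ 2) /
        v ^ 2 * ε := by positivity
    have h3 : (2 * L) ^ 2 ≤
        16 * L ^ 2 * μ.real (lowWeightSet n K h lam v x x') := by nlinarith [sq_nonneg L]
    linarith

end ConditionalBias

end LinkRegression

end

/-! ### Assembly of the constants. -/

theorem theorem1 (d : ℕ) (hd : 1 ≤ d) (𝒳 : Set (LinkRegression.E d)) (h𝒳 : IsCompact 𝒳)
    (β L τ ν cX CX l u c₀ : ℝ) (hβ0 : 0 < β) (hβ1 : β ≤ 1) (hL : 0 < L) (hτ : 0 < τ)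
    (hν : 0 < ν) (hcX : 0 < cX) (hCX : 0 < CX) (hl : 0 < l) (hu : 0 < u) (hc₀ : 0 < c₀)
    (K : LinkRegression.E d → ℝ) (hK : LinkRegression.IsLinkKernel K) :
    ∃ C : ℝ, 0 < C ∧
      ∀ (x x' : 𝒳), LinkRegression.VolumeRegularAt 𝒳 c₀ (x : LinkRegression.E d) →
        LinkRegression.VolumeRegularAt 𝒳 c₀ (x' : LinkRegression.E d) →
      ∀ (Q : LinkRegression.holderClass 𝒳 β L → Kernel (𝒳 × 𝒳) ℝ) [∀ f, IsMarkovKernel (Q f)],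
        (∀ f, LinkRegression.HasMeanAndVarianceLT (Q f) f.1 τ) →
      ∀ (n : ℕ) (h lam : ℝ), 2 ≤ n → (n : ℝ) ^ (-(1 / (d : ℝ))) ≤ h → h ≤ 1 →
        1 / ((n : ℝ) * h ^ d) ^ ν ≤ lam → lam ≤ h ^ d →
      -- fixed design
      (∀ X : Fin n → 𝒳, LinkRegression.IsFixedDesign cX CX X →
        (∀ f, MemLp (LinkRegression.smoother K h lam x x') 2
          (LinkRegression.dataLaw (Measure.dirac X) (Q f))) ∧
        LinkRegression.rho1 (Measure.dirac X) Q K h lam x x' ≤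
          ENNReal.ofReal (C * h ^ (2 * β)) ∧
        LinkRegression.rho2 (Measure.dirac X) Q K h lam x x' ≤
          ENNReal.ofReal (C * (((n : ℝ) * h ^ d) ^ 2)⁻¹) ∧
        LinkRegression.rho3 (Measure.dirac X) Q K h lam x x' = 0) ∧
      -- random design
      (∀ m : 𝒳 → ℝ, LinkRegression.IsDesignDensity l u m →
        (∀ f, MemLp (LinkRegression.smoother K h lam x x') 2
          (LinkRegression.dataLaw (LinkRegression.randomDesignLaw n m) (Q f))) ∧
        LinkRegression.rho1 (LinkRegression.randomDesignLaw n m) Q K h lam x x' ≤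
          ENNReal.ofReal (C * h ^ (2 * β)) ∧
        LinkRegression.rho2 (LinkRegression.randomDesignLaw n m) Q K h lam x x' ≤
          ENNReal.ofReal (C * (((n : ℝ) * h ^ d) ^ 2)⁻¹) ∧
        LinkRegression.rho3 (LinkRegression.randomDesignLaw n m) Q K h lam x x' ≤
          ENNReal.ofReal (C * h ^ (2 * β) * ((n : ℝ) * h ^ d)⁻¹)) := by
  obtain ⟨M, κ, R, r, hKB⟩ := hK.exists_kernelBounds
  have h𝒳m : MeasurableSet 𝒳 := h𝒳.measurableSet
  obtain ⟨v₁, hv₁, D₁, hD₁, hfix⟩ :=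
    LinkRegression.IsFixedDesign.exists_measureReal_lowWeightSet_le (𝒳 := 𝒳) (cX := cX) hKB hν
      hCX hc₀
  obtain ⟨v₂, hv₂, D₂, hD₂, hrand⟩ :=
    LinkRegression.IsDesignDensity.exists_measureReal_lowWeightSet_le (u := u) h𝒳m hKB hν hl hc₀
  have hR : 0 ≤ R := zero_le_one.trans hKB.one_le_R
  set A₁ := fun v D : ℝ => (2 * L * R + 2 * L / v) ^ 2 + (2 * L) ^ 2 * D with hA₁
  set A₂ := fun v D : ℝ => 8 * M ^ 2 / v * τ + τ * D with hA₂
  set A₃ := (384 * (2 * L * R + (2 * L * R + 4 * L / v₂)) ^ 2 * (2 * u + 1) ^ 4 * M ^ 2) / v₂ ^ 2 +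
    16 * L ^ 2 * D₂ with hA₃
  have h1 : 0 ≤ A₁ v₁ D₁ := by positivity
  have h2 : 0 ≤ A₂ v₁ D₁ := by positivity
  have h3 : 0 ≤ A₁ v₂ D₂ := by positivity
  have h4 : 0 ≤ A₂ v₂ D₂ := by positivity
  have h5 : 0 ≤ A₃ := by positivity
  -- One summand per term and design; the final $1$ only ensures positivity.
  refine ⟨A₁ v₁ D₁ + A₂ v₁ D₁ + A₁ v₂ D₂ + A₂ v₂ D₂ + A₃ + 1, by positivity, ?_⟩
  intro x x' hx hx' Q _ hQ n h lam hn hnh hh1 hlam hlam'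
  have H := LinkRegression.tuning_of_bounds hd hn hnh hh1 hlam hlam'
  have hs := H.nh_pos
  have hhβ : 0 ≤ h ^ (2 * β) := Real.rpow_nonneg H.h_pos.le _
  have hhβ1 : h ^ (2 * β) ≤ 1 := Real.rpow_le_one H.h_pos.le hh1 (by positivity)
  set t := ((n : ℝ) * h ^ d)⁻¹ with ht
  have ht0 : 0 ≤ t := inv_nonneg.2 hs.le
  have ht1 : t ≤ 1 := inv_le_one_of_one_le₀ H.one_le_nh
  have ht2 : t ^ 2 ≤ t := by nlinarith
  have hrate := H.rpow_neg_le hβ1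
  rw [← inv_pow] at hrate ⊢
  rw [← ht] at hrate ⊢
  -- One tail bound serves all three rates, because $h^{2\beta}$ and $t=(nh^d)^{-1}$ are at most
  -- one.
  have hlow : ∀ {D p : ℝ}, 0 ≤ D → p ≤ D * (((n : ℝ) * h ^ d) ^ (2 * ν + 2))⁻¹ →
      p ≤ D * h ^ (2 * β) ∧ p ≤ D * t ^ 2 ∧ p ≤ D * (h ^ (2 * β) * t) := by
    intro D p hD hp
    have hp' := hp.trans (mul_le_mul_of_nonneg_left hrate hD)
    refine ⟨hp'.trans (mul_le_mul_of_nonneg_left ?_ hD),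
      hp'.trans (mul_le_mul_of_nonneg_left ?_ hD),
      hp'.trans (mul_le_mul_of_nonneg_left ?_ hD)⟩
    · exact mul_le_of_le_one_right hhβ (ht2.trans ht1)
    · exact mul_le_of_le_one_left (sq_nonneg t) hhβ1
    · exact mul_le_mul_of_nonneg_left ht2 hhβ
  refine ⟨fun X hX => ?_, fun m hm => ?_⟩
  · obtain ⟨e1, e2, -⟩ := hlow hD₁ (hfix n h lam H X hX x x' hx hx')
    refine ⟨fun f => LinkRegression.memLp_smoother _ hKB H hτ.le f.2 (hQ f) x x', ?_, ?_, ?_⟩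
    · exact (LinkRegression.rho1_le _ hKB H hL.le hτ.le hβ0.le hβ1 hQ x x' hv₁ e1).trans
        (ENNReal.ofReal_le_ofReal (mul_le_mul_of_nonneg_right (by linarith) hhβ))
    · rw [ht, inv_pow] at e2 ⊢
      exact (LinkRegression.rho2_le _ hKB H hτ.le hQ x x' hv₁ e2).trans
        (ENNReal.ofReal_le_ofReal (mul_le_mul_of_nonneg_right (by linarith) (by positivity)))
    · rw [LinkRegression.rho3_eq _ hKB H hτ.le hQ]
      -- Under a Dirac law every variance vanishes.
      simp
  · have := hm.isProbabilityMeasure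
    have : IsProbabilityMeasure (LinkRegression.randomDesignLaw n m) := by
      rw [LinkRegression.randomDesignLaw]; infer_instance
    obtain ⟨e1, e2, e3⟩ := hlow hD₂ (hrand n h lam H m hm x x' hx hx')
    refine ⟨fun f => LinkRegression.memLp_smoother _ hKB H hτ.le f.2 (hQ f) x x', ?_, ?_, ?_⟩
    · exact (LinkRegression.rho1_le _ hKB H hL.le hτ.le hβ0.le hβ1 hQ x x' hv₂ e1).trans
        (ENNReal.ofReal_le_ofReal (mul_le_mul_of_nonneg_right (by linarith) hhβ))
    · rw [ht, inv_pow] at e2 ⊢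
      exact (LinkRegression.rho2_le _ hKB H hτ.le hQ x x' hv₂ e2).trans
        (ENNReal.ofReal_le_ofReal (mul_le_mul_of_nonneg_right (by linarith) (by positivity)))
    · rw [LinkRegression.rho3_eq _ hKB H hτ.le hQ]
      refine iSup_le fun f => ENNReal.ofReal_le_ofReal ?_
      refine (hm.variance_condMean_le h𝒳m hKB H hL.le hβ0.le hβ1 f.2 (hQ f) hu.le x x' hv₂
        e3).trans ?_
      rw [mul_assoc (A₁ v₁ D₁ + A₂ v₁ D₁ + A₁ v₂ D₂ + A₂ v₂ D₂ + A₃ + 1)]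
      exact mul_le_mul_of_nonneg_right (by linarith) (mul_nonneg hhβ ht0)
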